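/- Let $q$ be a prime power and let $t,k,n$ be integers with $1\le t<k<n$. For $0\le j\le n$ write ${n\brack j}_q=\prod_{i=0}^{j-1}\frac{q^{n-i}-1}{q^{i+1}-1}$ for the Gaussian binomial coefficient. Let $\mathrm{Gr}_{n,k}(\mathbb F_q)$ be the set of all $k$-dimensional subspaces of $\mathbb F_q^n$. A $q$-Steiner system with parameters $(t,k,n)$ is a set $\mathfrak B\subseteq \mathrm{Gr}_{n,k}(\mathbb F_q)$ such that every $t$-dimensional subspace of $\mathbb F_q^n$ is contained in exactly one element of $\mathfrak B$; let $S_q(t,k,n)$ be the collection of all of them. The characteristic vector of $\mathfrak B$ is the vector $\chi_{\mathfrak B}\in\{0,1\}^{\mathrm{Gr}_{n,k}(\mathbb F_q)}\subseteq\mathbb Q^{\mathrm{Gr}_{n,k}(\mathbb F_q)}$ whose $A$-entry is $1$ if and only if $A\in\mathfrak B$. If $S_q(t,k,n)$ is non-empty, then $$\dim_{\mathbb Q}\operatorname{span}_{\mathbb Q}\{\chi_{\mathfrak B} : \mathfrak B\in S_q(t,k,n)\}={n\brack k}_q-{n\brack t}_q+1.$$ -/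

import Mathlib

namespace QSteiner

/-- The Gaussian binomial coefficient `[n choose k]_q`, as the rational number
`((q^n - 1)(q^(n-1) - 1) ⋯ (q^(n-k+1) - 1)) / ((q^k - 1)(q^(k-1) - 1) ⋯ (q - 1))`. -/
def gaussBinom (q n k : ℕ) : ℚ :=
  (∏ i ∈ Finset.range k, ((q : ℚ) ^ (n - i) - 1)) /
    ∏ i ∈ Finset.range k, ((q : ℚ) ^ (i + 1) - 1)

/-- The Grassmannian of `k`-dimensional subspaces of `F^n`. -/
abbrev Gr (F : Type*) [Field F] (n k : ℕ) : Type _ :=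
  {W : Submodule F (Fin n → F) // Module.finrank F W = k}

/-- `B` is the set of blocks of a `t-(n, k, l)_q` subspace design: every `t`-dimensional
subspace is contained in exactly `l` blocks. -/
def IsSubspaceDesign {F : Type*} [Field F] {n k : ℕ} (t l : ℕ) (B : Set (Gr F n k)) : Prop :=
  ∀ T : Gr F n t, {X : Gr F n k | X ∈ B ∧ T.1 ≤ X.1}.encard = l

/-- The collection `S_q(t, k, n)` of all `q`-Steiner systems in `F^n`, where `F` has order `q`. -/
def steinerSystems (F : Type*) [Field F] (t k n : ℕ) : Set (Set (Gr F n k)) :=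
  {B | IsSubspaceDesign t 1 B}

/-- The characteristic vector of a set of `k`-dimensional subspaces. -/
noncomputable def charVec {F : Type*} [Field F] {n k : ℕ} (B : Set (Gr F n k)) : Gr F n k → ℚ :=
  B.indicator 1

/-- The rational vector space generated by all `q`-Steiner systems in `S_q(t, k, n)`. -/
noncomputable def steinerSpace (F : Type*) [Field F] (t k n : ℕ) : Submodule ℚ (Gr F n k → ℚ) :=
  Submodule.span ℚ (charVec '' steinerSystems F t k n)

end QSteiner

/-!
Let `V = F ^ n`, let `q` be the order of `F`, and for a function `h` on the `k`-dimensional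
subspaces let `upSum a h` be the function `T ↦ ∑ X ≥ T, h X` on the `a`-dimensional subspaces. The
characteristic vector `χ` of a Steiner system satisfies `upSum t χ = 1`, so the span `W` of these
vectors is contained in `K + ℚ χ`, where `K = ker (upSum t)`. The theorem says that equality holds
and that `upSum t` is surjective.

*Moments.* The number of `r`-tuples of vectors in `X ⊓ Z` is `q ^ (r * dim (X ⊓ Z))`. Hence, if
`upSum a h` is constant, the sums `∑ X, h X * P (q ^ dim (X ⊓ Z))` with `deg P ≤ a` depend only on
that constant (`exists_sum_mul_eval_eq`). Taking for `Z` a `k`-dimensional subspace and for `P` the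
polynomial that vanishes at all `q ^ dim (X ⊓ Z)` with `X ≠ Z` gives injectivity of `upSum a` when
`n ≤ a + k` (`eq_zero_of_upSum_eq_zero`). By duality, `upSum t` is surjective when `k + t ≤ n`
(`upSum_surjective`, Kantor's theorem). The existence of a Steiner system forces `k + t < n`, since
otherwise its characteristic vector would be constant (`IsSteiner.add_lt_finrank`).

*The inclusion `K ≤ W`.* If it fails, there is a nonzero `h ∈ K` orthogonal to `W ⊓ K`. Differences of
characteristic vectors lie in `W ⊓ K`, so `∑ X ∈ B, h X` is the same for all Steiner systems `B`.
By induction on `i`, `upSum i h = 0` for `t ≤ i ≤ min k (n - k)`, which gives `h = 0`. The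
induction step (`upSum_eq_zero_of_sum_indicator_eq`) fixes `Z` of dimension `i` and averages over its
stabilizer in the general linear group: with `H s` the sum of `h` over the `X` meeting `Z` in
dimension `s`, `N s` the number of these `X`, and `b s` the number of these `X` in `B`, the sum
`∑ s, b s * H s / N s` does not depend on `B`. Now compare a system with a block containing `Z` and
one with a block meeting `Z` in a hyperplane of `Z`. Above `t`, the difference `δ` of their
distributions is `1` at `i`, `-1` at `i - 1` (if `i - 1 > t`) and `0` elsewhere. By the moment
identities, `δ` is orthogonal to the polynomials of degree at most `t` on the nodes `q ^ s`, and `H`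
to those of degree less than `i`. So `δ` is explicit, `H` is explicit up to the factor `H i`, and
`∑ s, δ s * H s / N s = 0`. For `i = t + 1` this is `H i` times a positive sum of squares. For
`i ≥ t + 2` and a prime `p` dividing `q`, the `p`-adic norm of `N s` is that of
`q ^ ((i - s) * (k - s))`, and if `H i ≠ 0` then the term with `s = 0` has strictly larger norm than
all the other terms (`eq_zero_of_sum_mul_div_eq_zero`). Hence `H i = 0`, that is, `upSum i h Z = 0`.
-/

namespace QSteiner

open Module Polynomial
open scoped Classical

/-! ### Transitivity of the general linear group -/

section LinearAlgebra

variable {F V : Type*} [Field F] [AddCommGroup V] [Module F V]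

theorem map_eq_of_extends {A A' : Submodule F V} (e : A ≃ₗ[F] A') (g : V ≃ₗ[F] V)
    (h : ∀ a : A, g a = e a) : A.map (g : V →ₗ[F] V) = A' := by
  ext y
  simp only [Submodule.mem_map, LinearEquiv.coe_coe]
  constructor
  · rintro ⟨x, hx, rfl⟩
    rw [h ⟨x, hx⟩]
    exact (e ⟨x, hx⟩).2
  · intro hy
    refine ⟨e.symm ⟨y, hy⟩, (e.symm ⟨y, hy⟩).2, ?_⟩
    rw [h]
    simp

theorem map_le_map_equiv_iff (g : V ≃ₗ[F] V) {P Q : Submodule F V} :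
    P.map (g : V →ₗ[F] V) ≤ Q.map (g : V →ₗ[F] V) ↔ P ≤ Q :=
  Submodule.map_le_map_iff_of_injective g.injective _ _

theorem finrank_map_inf_map (g : V ≃ₗ[F] V) (P Q : Submodule F V) :
    finrank F ↥(P.map (g : V →ₗ[F] V) ⊓ Q.map (g : V →ₗ[F] V)) = finrank F ↥(P ⊓ Q) := by
  rw [← Submodule.map_inf (g : V →ₗ[F] V) g.injective, LinearEquiv.finrank_map_eq]

theorem finrank_comap_subtype_eq (X Z : Submodule F V) :
    finrank F (X.comap Z.subtype) = finrank F ↥(X ⊓ Z) := by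
  rw [inf_comm, ← Submodule.map_comap_subtype]
  exact LinearEquiv.finrank_eq (Submodule.equivSubtypeMap _ _)

variable [FiniteDimensional F V]

theorem exists_linearEquiv_extending_of_disjoint {A C A' C' : Submodule F V}
    (h : Disjoint A C) (h' : Disjoint A' C') (eA : A ≃ₗ[F] A') (eC : C ≃ₗ[F] C') :
    ∃ g : V ≃ₗ[F] V, (∀ a : A, g a = eA a) ∧ ∀ c : C, g c = eC c := by
  have inj : ∀ {P Q : Submodule F V}, Disjoint P Q →
      Function.Injective (P.subtype.coprod Q.subtype) := by
    intro P Q hPQ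
    rw [← LinearMap.ker_eq_bot, LinearMap.ker_coprod_of_disjoint_range _ _ (by simpa using hPQ)]
    simp
  let φ := LinearEquiv.ofInjective _ (inj h)
  let φ' := LinearEquiv.ofInjective _ (inj h')
  obtain ⟨g, hg⟩ := Submodule.exists_linearEquiv_restrict_eq
    (φ.symm ≪≫ₗ (LinearEquiv.prodCongr eA eC) ≪≫ₗ φ')
  have key : ∀ x : A × C, g (φ x) = φ' (eA x.1, eC x.2) := by
    intro x
    rw [← hg (φ x)]
    simp
  refine ⟨g, fun a => ?_, fun c => ?_⟩
  · simpa [φ, φ', LinearMap.coprod_apply] using key (a, 0)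
  · simpa [φ, φ', LinearMap.coprod_apply] using key (0, c)

theorem finrank_sup_of_disjoint {A B : Submodule F V} (h : Disjoint A B) :
    finrank F ↥(A ⊔ B) = finrank F A + finrank F B := by
  have := Submodule.finrank_sup_add_finrank_inf_eq A B
  rw [h.eq_bot, finrank_bot] at this
  omega

/-- The relative position of two subspaces is determined by their dimensions and the dimension
of their intersection. -/
theorem exists_linearEquiv_map_eq {X X' Z Z' : Submodule F V}
    (hX : finrank F X = finrank F X') (hZ : finrank F Z = finrank F Z')
    (hXZ : finrank F ↥(X ⊓ Z) = finrank F ↥(X' ⊓ Z')) :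
    ∃ g : V ≃ₗ[F] V, X.map (g : V →ₗ[F] V) = X' ∧ Z.map (g : V →ₗ[F] V) = Z' := by
  obtain ⟨A, hA, hA'⟩ := IsModularLattice.exists_disjoint_and_sup_eq (inf_le_right : X ⊓ Z ≤ Z)
  obtain ⟨B, hB, hB'⟩ := IsModularLattice.exists_disjoint_and_sup_eq (inf_le_right : X' ⊓ Z' ≤ Z')
  obtain ⟨C, hC, hC'⟩ := IsModularLattice.exists_disjoint_and_sup_eq (inf_le_left : X ⊓ Z ≤ X)
  obtain ⟨D, hD, hD'⟩ := IsModularLattice.exists_disjoint_and_sup_eq (inf_le_left : X' ⊓ Z' ≤ X')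
  have dA := finrank_sup_of_disjoint hA
  have dB := finrank_sup_of_disjoint hB
  have dC := finrank_sup_of_disjoint hC
  have dD := finrank_sup_of_disjoint hD
  rw [hA'] at dA
  rw [hB'] at dB
  rw [hC'] at dC
  rw [hD'] at dD
  have eS := LinearEquiv.ofFinrankEq _ _ hXZ
  obtain ⟨g₁, h₁, h₂⟩ := exists_linearEquiv_extending_of_disjoint hA hB eS
    (LinearEquiv.ofFinrankEq A B (by omega))
  have hS := map_eq_of_extends _ g₁ h₁
  have hg₁ : Z.map (g₁ : V →ₗ[F] V) = Z' := by
    have := map_eq_of_extends _ g₁ h₂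
    rw [← hA', ← hB', Submodule.map_sup, hS, this]
  have dZC : Disjoint Z C := by
    rw [disjoint_iff_inf_le]
    have : C ≤ X := hC' ▸ le_sup_right
    exact (le_inf (le_inf (inf_le_right.trans this) inf_le_left) inf_le_right).trans
      (disjoint_iff_inf_le.1 hC)
  have dZD : Disjoint Z' D := by
    rw [disjoint_iff_inf_le]
    have : D ≤ X' := hD' ▸ le_sup_right
    exact (le_inf (le_inf (inf_le_right.trans this) inf_le_left) inf_le_right).trans
      (disjoint_iff_inf_le.1 hD)
  obtain ⟨g, h₃, h₄⟩ := exists_linearEquiv_extending_of_disjoint dZC dZD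
    (g₁.ofSubmodules Z Z' hg₁) (LinearEquiv.ofFinrankEq C D (by omega))
  refine ⟨g, ?_, map_eq_of_extends _ g h₃⟩
  have hS' : (X ⊓ Z).map (g : V →ₗ[F] V) = X' ⊓ Z' := by
    rw [← hS]
    ext y
    simp only [Submodule.mem_map, LinearEquiv.coe_coe]
    have : ∀ x ∈ X ⊓ Z, g x = g₁ x := fun x hx => h₃ ⟨x, hx.2⟩
    constructor
    · rintro ⟨x, hx, rfl⟩
      exact ⟨x, hx, (this x hx).symm⟩
    · rintro ⟨x, hx, rfl⟩
      exact ⟨x, hx, this x hx⟩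
  have := map_eq_of_extends _ g h₄
  rw [← hC', Submodule.map_sup, hS', this, hD']

theorem exists_between_finrank_eq {R X : Submodule F V} (h : R ≤ X) {a : ℕ}
    (h₁ : finrank F R ≤ a) (h₂ : a ≤ finrank F X) :
    ∃ T : Submodule F V, R ≤ T ∧ T ≤ X ∧ finrank F T = a := by
  obtain ⟨C, hC, hC'⟩ := IsModularLattice.exists_disjoint_and_sup_eq h
  have dC := finrank_sup_of_disjoint hC
  rw [hC'] at dC
  obtain ⟨f, hf⟩ := exists_linearIndependent_of_le_finrank (R := F) (M := C)
    (n := a - finrank F R) (by omega)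
  have hf' : LinearIndependent F (fun j => (f j : V)) := hf.map' C.subtype (by simp)
  have hle : Submodule.span F (Set.range fun j => (f j : V)) ≤ C := by
    rw [Submodule.span_le]
    rintro _ ⟨j, rfl⟩
    exact (f j).2
  refine ⟨R ⊔ Submodule.span F (Set.range fun j => (f j : V)), le_sup_left,
    sup_le h (hle.trans (hC' ▸ le_sup_right)), ?_⟩
  rw [finrank_sup_of_disjoint (hC.mono_right hle), finrank_span_eq_card hf']
  simp
  omega

end LinearAlgebra

/-! ### Sums over the blocks containing a subspace -/

/-- The set of `k`-dimensional subspaces of a vector space `V`. -/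
abbrev Grass (F V : Type*) [Field F] [AddCommGroup V] [Module F V] (k : ℕ) : Type _ :=
  {W : Submodule F V // finrank F W = k}

/-- An enumeration of the Grassmannian, chosen arbitrarily: only finite sums over it are used. -/
noncomputable instance grassFintype (F V : Type*) [Field F] [AddCommGroup V] [Module F V]
    [Finite V] (k : ℕ) : Fintype (Grass F V k) := Fintype.ofFinite _

section Sums

variable {F V : Type*} [Field F] [AddCommGroup V] [Module F V] {a d k : ℕ}

/-- The action of the general linear group on the Grassmannian. -/
noncomputable def grassMap (g : V ≃ₗ[F] V) (k : ℕ) : Grass F V k ≃ Grass F V k where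
  toFun X := ⟨X.1.map (g : V →ₗ[F] V), by rw [LinearEquiv.finrank_map_eq, X.2]⟩
  invFun X := ⟨X.1.map (g.symm : V →ₗ[F] V), by rw [LinearEquiv.finrank_map_eq, X.2]⟩
  left_inv X := by
    ext1
    simp only [← Submodule.map_comp, LinearEquiv.symm_comp, Submodule.map_id]
  right_inv X := by
    ext1
    simp only [← Submodule.map_comp, LinearEquiv.comp_symm, Submodule.map_id]

theorem grassMap_coe (g : V ≃ₗ[F] V) (X : Grass F V k) :
    (grassMap g k X).1 = X.1.map (g : V →ₗ[F] V) := rfl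

variable [Finite V]

/-- The inclusion matrix of `a`-dimensional against `k`-dimensional subspaces, as a linear map:
`upSum a h` sends `T` to the sum of `h` over all `X` containing `T`. -/
noncomputable def upSum (a : ℕ) : (Grass F V k → ℚ) →ₗ[ℚ] (Grass F V a → ℚ) where
  toFun h T := ∑ X : Grass F V k, if T.1 ≤ X.1 then h X else 0
  map_add' h h' := by
    ext T
    simp [← Finset.sum_add_distrib, ite_add_ite]
  map_smul' c h := by
    ext T
    simp [Finset.mul_sum]

theorem upSum_apply (h : Grass F V k → ℚ) (T : Grass F V a) :
    upSum a h T = ∑ X : Grass F V k, if T.1 ≤ X.1 then h X else 0 := rfl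

theorem card_between_eq {R R' X X' : Submodule F V} (hR : R ≤ X) (hR' : R' ≤ X')
    (h₁ : finrank F R = finrank F R') (h₂ : finrank F X = finrank F X') (a : ℕ) :
    Fintype.card {T : Grass F V a // R ≤ T.1 ∧ T.1 ≤ X} =
      Fintype.card {T : Grass F V a // R' ≤ T.1 ∧ T.1 ≤ X'} := by
  obtain ⟨g, rfl, rfl⟩ := exists_linearEquiv_map_eq h₁ h₂
    (by rw [inf_eq_left.2 hR, inf_eq_left.2 hR', h₁])
  refine Fintype.card_congr ((grassMap g a).subtypeEquiv fun T => ?_)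
  rw [grassMap_coe, map_le_map_equiv_iff, map_le_map_equiv_iff]

/-- If the sums of `h` over the `k`-spaces containing an `a`-space are all equal, so are the sums
over the `k`-spaces containing a `d`-space, for all `d ≤ a`; the proportionality factor does not
depend on `h`. For `h` a characteristic vector this says that an `a`-design is a `d`-design. -/
theorem exists_upSum_eq_of_le (hd : d ≤ a) (hak : a ≤ k) :
    ∃ κ : ℚ, ∀ (h : Grass F V k → ℚ) (c : ℚ), (∀ T : Grass F V a, upSum a h T = c) →
      ∀ R : Grass F V d, upSum d h R = c * κ := by
  by_cases hex : ∃ (R₀ : Grass F V d) (X₀ : Grass F V k), R₀.1 ≤ X₀.1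
  · obtain ⟨R₀, X₀, h₀⟩ := hex
    set m := Fintype.card {T : Grass F V a // R₀.1 ≤ T.1 ∧ T.1 ≤ X₀.1} with hm
    set M := Fintype.card {T : Grass F V a // R₀.1 ≤ T.1 ∧ T.1 ≤ ⊤} with hM
    have hmpos : (m : ℚ) ≠ 0 := by
      obtain ⟨T, hT₁, hT₂, hT₃⟩ := exists_between_finrank_eq h₀ (a := a)
        (by rw [R₀.2]; exact hd) (by rw [X₀.2]; exact hak)
      have : Nonempty {T : Grass F V a // R₀.1 ≤ T.1 ∧ T.1 ≤ X₀.1} := ⟨⟨⟨T, hT₃⟩, hT₁, hT₂⟩⟩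
      exact_mod_cast Fintype.card_ne_zero
    refine ⟨M / m, fun h c hc R => ?_⟩
    have e₁ : ∑ T : Grass F V a, (if R.1 ≤ T.1 then upSum a h T else 0) = c * M := by
      simp_rw [hc]
      rw [hM, ← card_between_eq (R := R.1) le_top le_top (R.2.trans R₀.2.symm) rfl,
        Fintype.card_subtype]
      simp [← Finset.sum_filter, mul_comm]
    have e₂ : ∑ T : Grass F V a, (if R.1 ≤ T.1 then upSum a h T else 0) = upSum d h R * m := by
      simp_rw [upSum_apply, ← Finset.sum_filter (p := fun T : Grass F V a => R.1 ≤ T.1)]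
      rw [Finset.sum_comm, Finset.sum_mul]
      refine Finset.sum_congr rfl fun X _ => ?_
      split_ifs with hRX
      · rw [hm, ← card_between_eq hRX h₀ (R.2.trans R₀.2.symm) (X.2.trans X₀.2.symm),
          Fintype.card_subtype, ← Finset.sum_filter, Finset.filter_filter]
        simp [mul_comm]
      · rw [zero_mul]
        refine Finset.sum_eq_zero fun T hT => if_neg fun hTX => hRX ?_
        exact (Finset.mem_filter.1 hT).2.trans hTX
    rw [eq_comm, mul_div_assoc', div_eq_iff hmpos, ← e₁, e₂]
  · push Not at hex
    refine ⟨0, fun h c _ R => ?_⟩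
    rw [upSum_apply, mul_zero]
    exact Finset.sum_eq_zero fun X _ => if_neg (hex R X)

/-- The number of `r`-tuples of vectors in `W` is `q ^ (r * dim W)`. -/
theorem card_pow_finrank_pow_eq_sum (W : Submodule F V) (r : ℕ) [Fintype V] :
    ((Nat.card F : ℚ) ^ finrank F W) ^ r =
      ∑ z : Fin r → V, if Submodule.span F (Set.range z) ≤ W then 1 else 0 := by
  rw [← Finset.sum_filter, Finset.sum_const, nsmul_eq_mul, mul_one, ← Fintype.card_subtype]
  have e : {z : Fin r → V // Submodule.span F (Set.range z) ≤ W} ≃ (Fin r → W) :=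
    { toFun := fun z j => ⟨z.1 j, z.2 (Submodule.subset_span ⟨j, rfl⟩)⟩
      invFun := fun z => ⟨fun j => z j, by
        rw [Submodule.span_le]
        rintro _ ⟨j, rfl⟩
        exact (z j).2⟩
      left_inv := fun z => rfl
      right_inv := fun z => rfl }
  rw [Fintype.card_congr e, Fintype.card_fun, Fintype.card_fin, ← Nat.card_eq_fintype_card (α := W),
    Module.natCard_eq_pow_finrank (K := F) (V := W)]
  push_cast
  ring

/-- The moments of the distribution of `h` with respect to a fixed subspace `Z`: if `h` has constant
sums over the blocks containing an `a`-space, then `∑ X, h X * P (q ^ dim (X ⊓ Z))` is determined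
by that constant for all polynomials `P` of degree at most `a`. -/
theorem exists_sum_mul_eval_eq (hak : a ≤ k) (Z : Submodule F V) (P : ℚ[X])
    (hP : P.natDegree ≤ a) :
    ∃ κ : ℚ, ∀ (h : Grass F V k → ℚ) (c : ℚ), (∀ T : Grass F V a, upSum a h T = c) →
      ∑ X : Grass F V k, h X * P.eval ((Nat.card F : ℚ) ^ finrank F ↥(X.1 ⊓ Z)) = c * κ := by
  have := Fintype.ofFinite V
  have mono : ∀ r : ℕ, ∃ κ : ℚ, r ≤ a → ∀ (h : Grass F V k → ℚ) (c : ℚ),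
      (∀ T : Grass F V a, upSum a h T = c) →
      ∑ X : Grass F V k, h X * ((Nat.card F : ℚ) ^ finrank F ↥(X.1 ⊓ Z)) ^ r = c * κ := by
    intro r
    by_cases hr : r ≤ a
    · have hle : ∀ z : Fin r → V, finrank F (Submodule.span F (Set.range z)) ≤ a := fun z =>
        (finrank_range_le_card z).trans (by simpa using hr)
      choose κ hκ using fun z : Fin r → V =>
        exists_upSum_eq_of_le (F := F) (V := V) (hle z) hak
      refine ⟨∑ z : Fin r → V, if Submodule.span F (Set.range z) ≤ Z then κ z else 0,
        fun _ h c hc => ?_⟩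
      simp_rw [card_pow_finrank_pow_eq_sum, Finset.mul_sum]
      rw [Finset.sum_comm]
      refine Finset.sum_congr rfl fun z _ => ?_
      by_cases hz : Submodule.span F (Set.range z) ≤ Z
      · rw [if_pos hz, ← hκ z h c hc ⟨_, rfl⟩, upSum_apply]
        refine Finset.sum_congr rfl fun X _ => ?_
        simp [le_inf_iff, hz]
      · simp [le_inf_iff, hz]
    · exact ⟨0, fun h => absurd h hr⟩
  choose κ hκ using mono
  refine ⟨∑ r ∈ Finset.range (a + 1), P.coeff r * κ r, fun h c hc => ?_⟩
  simp_rw [eval_eq_sum_range' (Nat.lt_succ_of_le hP), Finset.mul_sum]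
  rw [Finset.sum_comm]
  refine Finset.sum_congr rfl fun r hr => ?_
  have := hκ r (Nat.lt_succ_iff.1 (Finset.mem_range.1 hr)) h c hc
  rw [mul_left_comm, ← this, Finset.mul_sum]
  refine Finset.sum_congr rfl fun X _ => ?_
  ring

theorem sum_mul_eval_eq_zero (hak : a ≤ k) (Z : Submodule F V) {P : ℚ[X]}
    (hP : P.natDegree ≤ a) {h : Grass F V k → ℚ} (hh : upSum a h = 0) :
    ∑ X : Grass F V k, h X * P.eval ((Nat.card F : ℚ) ^ finrank F ↥(X.1 ⊓ Z)) = 0 := by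
  obtain ⟨κ, hκ⟩ := exists_sum_mul_eval_eq (k := k) hak Z P hP
  simpa using hκ h 0 (fun T => by rw [hh]; rfl)

end Sums

/-! ### Kantor's theorem on inclusion matrices -/

section Kantor

/-- The monic polynomial with roots `q ^ s` for `s ∈ S`. -/
noncomputable def qRoots (q : ℕ) (S : Finset ℕ) : ℚ[X] := ∏ s ∈ S, (X - C ((q : ℚ) ^ s))

theorem qRoots_eval (q : ℕ) (S : Finset ℕ) (x : ℚ) :
    (qRoots q S).eval x = ∏ s ∈ S, (x - (q : ℚ) ^ s) := by
  simp [qRoots, eval_prod]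

theorem qRoots_natDegree (q : ℕ) (S : Finset ℕ) : (qRoots q S).natDegree = S.card := by
  exact natDegree_finsetProd_X_sub_C_eq_card S fun s => (q : ℚ) ^ s

theorem qRoots_eval_eq_zero (q : ℕ) {S : Finset ℕ} {s : ℕ} (hs : s ∈ S) :
    (qRoots q S).eval ((q : ℚ) ^ s) = 0 := by
  rw [qRoots_eval]
  exact Finset.prod_eq_zero hs (sub_self _)

theorem qRoots_eval_ne_zero {q : ℕ} (hq : 1 < q) {S : Finset ℕ} {s : ℕ} (hs : s ∉ S) :
    (qRoots q S).eval ((q : ℚ) ^ s) ≠ 0 := by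
  rw [qRoots_eval, Finset.prod_ne_zero_iff]
  intro l hl h
  have h' : (q : ℚ) ^ s = (q : ℚ) ^ l := sub_eq_zero.1 h
  have h'' : q ^ s = q ^ l := by exact_mod_cast h'
  exact hs (Nat.pow_right_injective hq h'' ▸ hl)

variable {F V : Type*} [Field F] [AddCommGroup V] [Module F V] [Finite V] {a b k t : ℕ}

/-- Annihilators identify `t`-dimensional subspaces with subspaces of codimension `t` of the
dual space. -/
noncomputable def grassDual (ht : t ≤ finrank F V) :
    Grass F V t ≃ Grass F (Dual F V) (finrank F V - t) :=
  (Subspace.orderIsoFiniteDimensional.toEquiv.trans OrderDual.ofDual).subtypeEquiv fun W => by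
    have := Subspace.finrank_add_finrank_dualAnnihilator_eq W
    change _ ↔ finrank F W.dualAnnihilator = _
    omega

theorem grassDual_le_iff {d : ℕ} (ht : t ≤ finrank F V) (hd : d ≤ finrank F V) (T : Grass F V t)
    (X : Grass F V d) : (grassDual hd X).1 ≤ (grassDual ht T).1 ↔ T.1 ≤ X.1 :=
  (Subspace.orderIsoFiniteDimensional (K := F) (V := V)).le_iff_le (x := T.1) (y := X.1)

variable [Finite F]

/-- The moments with respect to `X₀` of a function in the kernel of `upSum a` vanish up to degree `a`.
The dimension of `X ⊓ X₀` takes at most `a + 1` values, so the moments determine the value at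
`X₀`. -/
theorem eq_zero_of_upSum_eq_zero (hab : a ≤ b) (hn : finrank F V ≤ a + b) {h : Grass F V b → ℚ}
    (hh : upSum a h = 0) : h = 0 := by
  ext X₀
  have hb : b ≤ finrank F V := X₀.2 ▸ Submodule.finrank_le _
  have hq : 1 < Nat.card F := Finite.one_lt_card
  -- the possible values of `dim (X ⊓ X₀)` for `X ≠ X₀`
  set S := Finset.Ico (2 * b - finrank F V) b with hS
  have := sum_mul_eval_eq_zero hab X₀.1 (P := qRoots (Nat.card F) S)
    (by rw [qRoots_natDegree, hS, Nat.card_Ico]; omega) hh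
  rw [Finset.sum_eq_single X₀] at this
  · refine (mul_eq_zero.1 this).resolve_right (qRoots_eval_ne_zero hq ?_)
    rw [inf_idem, X₀.2, hS]
    simp
  · intro X _ hX
    rw [qRoots_eval_eq_zero, mul_zero]
    rw [hS, Finset.mem_Ico]
    have h₁ := Submodule.finrank_sup_add_finrank_inf_eq X.1 X₀.1
    have h₂ := Submodule.finrank_le (X.1 ⊔ X₀.1)
    rw [X.2, X₀.2] at h₁
    refine ⟨by omega, lt_of_le_of_ne ?_ fun he => hX ?_⟩
    · exact (Submodule.finrank_mono inf_le_right).trans_eq X₀.2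
    · have e₁ := Submodule.eq_of_le_of_finrank_eq (inf_le_left : X.1 ⊓ X₀.1 ≤ _) (he.trans X.2.symm)
      have e₂ := Submodule.eq_of_le_of_finrank_eq (inf_le_right : X.1 ⊓ X₀.1 ≤ _)
        (he.trans X₀.2.symm)
      exact Subtype.ext (e₁.symm.trans e₂)
  · simp

/-- Kantor's theorem: the inclusion matrix of `t`-spaces against `k`-spaces has full row rank. -/
theorem upSum_surjective (htk : t ≤ k) (hk : k + t ≤ finrank F V) :
    Function.Surjective (upSum t : (Grass F V k → ℚ) →ₗ[ℚ] (Grass F V t → ℚ)) := by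
  rw [← LinearMap.dualMap_injective_iff, ← LinearMap.ker_eq_bot, LinearMap.ker_eq_bot']
  intro f hf
  have := Module.finite_of_finite F (M := Dual F V)
  have ht : t ≤ finrank F V := by omega
  have hk' : k ≤ finrank F V := by omega
  set g : Grass F (Dual F V) (finrank F V - t) → ℚ :=
    fun Y => f (Pi.single ((grassDual ht).symm Y) 1) with hg
  have key : upSum (finrank F V - k) g = 0 := by
    ext Y
    obtain ⟨X, rfl⟩ := (grassDual hk').surjective Y
    have h₁ : f (upSum t (Pi.single X 1)) = 0 := LinearMap.congr_fun hf (Pi.single X 1)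
    rw [LinearMap.pi_apply_eq_sum_univ f] at h₁
    rw [upSum_apply, ← (grassDual ht).sum_comp]
    refine Eq.trans (Finset.sum_congr rfl fun T _ => ?_) h₁
    rw [grassDual_le_iff, hg, upSum_apply, Finset.sum_eq_single X (fun Z _ hZ => by simp [hZ])
      (by simp)]
    have : (fun T' : Grass F V t => if T = T' then (1 : ℚ) else 0) = Pi.single T 1 := by
      ext T'
      simp [Pi.single_apply, eq_comm]
    simp [this]
  have hg0 := eq_zero_of_upSum_eq_zero (by omega)
    (by rw [Subspace.dual_finrank_eq]; omega) key
  ext T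
  have := congrFun hg0 (grassDual ht T)
  simpa [hg] using this

end Kantor

/-! ### Counting subspaces in given position -/

section Counting

/-- The number of linearly independent `m`-tuples of vectors in a `d`-dimensional space over
a field of order `q` (for `m ≤ d`). -/
def indepCount (q d m : ℕ) : ℚ := ∏ l ∈ Finset.range m, ((q : ℚ) ^ d - (q : ℚ) ^ l)

theorem indepCount_pos {q d m : ℕ} (hq : 1 < q) (h : m ≤ d) : 0 < indepCount q d m := by
  refine Finset.prod_pos fun l hl => sub_pos.2 ?_
  exact pow_lt_pow_right₀ (by exact_mod_cast hq) (by have := Finset.mem_range.1 hl; omega)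

variable {F V : Type*} [Field F] [Finite F] [AddCommGroup V] [Module F V] [Finite V]

theorem natCard_linearIndependent {m : ℕ} (h : m ≤ finrank F V) :
    (Nat.card {f : Fin m → V // LinearIndependent F f} : ℚ) =
      indepCount (Nat.card F) (finrank F V) m := by
  have := Fintype.ofFinite F
  rw [card_linearIndependent h, Nat.cast_prod, indepCount, ← Fin.prod_univ_eq_prod_range
    (fun l => (Nat.card F : ℚ) ^ finrank F V - (Nat.card F : ℚ) ^ l), Nat.card_eq_fintype_card]
  refine Finset.prod_congr rfl fun l _ => ?_
  rw [Nat.cast_sub (Nat.pow_le_pow_right Fintype.card_pos (by omega))]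
  simp

/-- The number of `m`-tuples that are linearly independent modulo `Y`. -/
theorem natCard_linearIndependent_mkQ (Y : Submodule F V) {m : ℕ}
    (h : m + finrank F Y ≤ finrank F V) :
    (Nat.card {f : Fin m → V // LinearIndependent F (Y.mkQ ∘ f)} : ℚ) =
      (Nat.card F : ℚ) ^ (finrank F Y * m) *
        indepCount (Nat.card F) (finrank F V - finrank F Y) m := by
  obtain ⟨σ, hσ⟩ := Y.mkQ.exists_rightInverse_of_surjective
    (LinearMap.range_eq_top.2 Y.mkQ_surjective)
  have hσ' : ∀ x, Y.mkQ (σ x) = x := fun x => LinearMap.congr_fun hσ x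
  let e : {f : Fin m → V // LinearIndependent F (Y.mkQ ∘ f)} ≃
      (Fin m → Y) × {g : Fin m → V ⧸ Y // LinearIndependent F g} :=
    { toFun := fun f => (fun j => ⟨f.1 j - σ (Y.mkQ (f.1 j)), by
        refine (Submodule.Quotient.mk_eq_zero Y).1 ?_
        change Y.mkQ _ = 0
        rw [map_sub, hσ', sub_self]⟩, ⟨_, f.2⟩)
      invFun := fun x => ⟨fun j => x.1 j + σ (x.2.1 j), by
        convert x.2.2 using 1
        ext j
        have : Y.mkQ (x.1 j : V) = 0 := by simp
        rw [Function.comp_apply, map_add, this, hσ', zero_add]⟩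
      left_inv := fun f => by
        ext j
        simp
      right_inv := fun x => by
        have h0 : ∀ j, Y.mkQ (x.1 j : V) = 0 := fun j => by simp
        refine Prod.ext (funext fun j => Subtype.ext ?_) (Subtype.ext (funext fun j => ?_))
        · change (x.1 j : V) + σ (x.2.1 j) - σ (Y.mkQ (x.1 j + σ (x.2.1 j))) = x.1 j
          rw [map_add, h0, hσ', zero_add, add_sub_cancel_right]
        · change Y.mkQ (x.1 j + σ (x.2.1 j)) = x.2.1 j
          rw [map_add, h0, hσ', zero_add] }
  have : Finite (V ⧸ Y) := Module.finite_of_finite F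
  have hd := Submodule.finrank_quotient_add_finrank Y
  rw [Nat.card_congr e, Nat.card_prod, Nat.cast_mul, natCard_linearIndependent (by omega),
    Nat.card_fun, Module.natCard_eq_pow_finrank (K := F) (V := Y),
    show finrank F (V ⧸ Y) = finrank F V - finrank F Y by omega]
  simp [pow_mul]

/-- For `U` disjoint from `Z`, the subspaces of dimension `s + dim U` that contain `U` and meet `Z` in
dimension `s` are the sums `S ⊔ U` with `S ≤ Z` of dimension `s`. -/
noncomputable def supEquiv {U Z : Submodule F V} (h : Disjoint U Z) (s : ℕ) :
    {X : Grass F V (s + finrank F U) // finrank F ↥(X.1 ⊓ Z) = s ∧ U ≤ X.1} ≃ Grass F Z s where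
  toFun X := ⟨(X.1.1).comap Z.subtype, (finrank_comap_subtype_eq _ _).trans X.2.1⟩
  invFun S :=
    have hS : S.1.map Z.subtype ≤ Z := Submodule.map_subtype_le _ _
    have hf : finrank F (S.1.map Z.subtype) = s :=
      (LinearEquiv.finrank_eq (Submodule.equivSubtypeMap _ _)).symm.trans S.2
    ⟨⟨S.1.map Z.subtype ⊔ U, by rw [finrank_sup_of_disjoint (h.symm.mono_left hS), hf]⟩, by
      refine ⟨?_, le_sup_right⟩
      rw [sup_inf_assoc_of_le _ hS, h.eq_bot, sup_bot_eq, hf]⟩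
  left_inv X := by
    refine Subtype.ext (Subtype.ext ?_)
    change (X.1.1.comap Z.subtype).map Z.subtype ⊔ U = X.1.1
    rw [Submodule.map_comap_subtype]
    refine Submodule.eq_of_le_of_finrank_eq (sup_le inf_le_right X.2.2) ?_
    rw [finrank_sup_of_disjoint (h.symm.mono_left inf_le_left), inf_comm, X.2.1, X.1.2]
  right_inv S := by
    refine Subtype.ext ?_
    change (S.1.map Z.subtype ⊔ U).comap Z.subtype = S.1
    have hS : S.1.map Z.subtype ≤ Z := Submodule.map_subtype_le _ _
    apply Submodule.map_injective_of_injective Z.injective_subtype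
    rw [Submodule.map_comap_subtype, inf_comm, sup_inf_assoc_of_le _ hS, h.eq_bot, sup_bot_eq]

/-- The number of subspaces of dimension `s + m` meeting `Z` in dimension `s`, by double counting of
the pairs formed by such a subspace and an `m`-tuple in it that is independent modulo `Z`. -/
theorem card_inf_finrank_eq (Z : Submodule F V) (s m : ℕ) (hm : m + finrank F Z ≤ finrank F V) :
    (Fintype.card {X : Grass F V (s + m) // finrank F ↥(X.1 ⊓ Z) = s} : ℚ) *
        ((Nat.card F : ℚ) ^ (s * m) * indepCount (Nat.card F) m m) =
      Fintype.card (Grass F Z s) * ((Nat.card F : ℚ) ^ (finrank F Z * m) *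
        indepCount (Nat.card F) (finrank F V - finrank F Z) m) := by
  have := Fintype.ofFinite V
  have := Fintype.ofFinite F
  let L := {f : Fin m → V // LinearIndependent F (Z.mkQ ∘ f)}
  let N := {X : Grass F V (s + m) // finrank F ↥(X.1 ⊓ Z) = s}
  have byX : ∀ X : N, (Fintype.card {f : L // Submodule.span F (Set.range f.1) ≤ X.1.1} : ℚ) =
      (Nat.card F : ℚ) ^ (s * m) * indepCount (Nat.card F) m m := by
    intro X
    let Y : Submodule F X.1.1 := Z.comap X.1.1.subtype
    have hY : finrank F Y = s := by
      refine (finrank_comap_subtype_eq _ _).trans ?_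
      rw [inf_comm]
      exact X.2
    have hli : ∀ f : Fin m → X.1.1, LinearIndependent F (Y.mkQ ∘ f) ↔
        LinearIndependent F (Z.mkQ ∘ fun j => (f j : V)) := by
      intro f
      let ι : (X.1.1 ⧸ Y) →ₗ[F] V ⧸ Z := Y.mapQ Z X.1.1.subtype le_rfl
      have hι : LinearMap.ker ι = ⊥ := by
        rw [Submodule.ker_mapQ, Submodule.mkQ_map_self]
      rw [← LinearMap.linearIndependent_iff ι hι]
      rfl
    have e : {f : L // Submodule.span F (Set.range f.1) ≤ X.1.1} ≃
        {f : Fin m → X.1.1 // LinearIndependent F (Y.mkQ ∘ f)} :=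
      { toFun := fun f => ⟨fun j => ⟨f.1.1 j, f.2 (Submodule.subset_span ⟨j, rfl⟩)⟩,
          (hli _).2 f.1.2⟩
        invFun := fun f => ⟨⟨fun j => f.1 j, (hli _).1 f.2⟩, by
          rw [Submodule.span_le]
          rintro _ ⟨j, rfl⟩
          exact (f.1 j).2⟩
        left_inv := fun f => rfl
        right_inv := fun f => rfl }
    rw [← Nat.card_eq_fintype_card, Nat.card_congr e, natCard_linearIndependent_mkQ _
      (by rw [hY, X.1.2]; omega), hY, X.1.2, Nat.add_sub_cancel_left]
  have byf : ∀ f : L, Fintype.card {X : N // Submodule.span F (Set.range f.1) ≤ X.1.1} =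
      Fintype.card (Grass F Z s) := by
    intro f
    have hf : LinearIndependent F f.1 := f.2.of_comp
    have hdis : Disjoint (Submodule.span F (Set.range f.1)) Z := by
      have := Submodule.range_ker_disjoint f.2
      rwa [Submodule.ker_mkQ] at this
    have hdim : finrank F (Submodule.span F (Set.range f.1)) = m := by
      rw [finrank_span_eq_card hf, Fintype.card_fin]
    have e := supEquiv hdis s
    rw [hdim] at e
    exact Fintype.card_congr ((Equiv.subtypeSubtypeEquivSubtypeInter _ 
      (fun X : Grass F V (s + m) => Submodule.span F (Set.range f.1) ≤ X.1)).trans e)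
  have total : ∑ X : N, (Fintype.card {f : L // Submodule.span F (Set.range f.1) ≤ X.1.1} : ℚ) =
      ∑ f : L, (Fintype.card {X : N // Submodule.span F (Set.range f.1) ≤ X.1.1} : ℚ) := by
    simp_rw [Fintype.card_subtype, Finset.card_filter, Nat.cast_sum]
    exact Finset.sum_comm
  rw [Finset.sum_congr rfl fun X _ => byX X,
    Finset.sum_congr rfl fun f _ => congrArg Nat.cast (byf f), Finset.sum_const, Finset.sum_const,
    Finset.card_univ, Finset.card_univ, nsmul_eq_mul, nsmul_eq_mul,
    ← Nat.card_eq_fintype_card (α := L), natCard_linearIndependent_mkQ Z hm] at total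
  rw [total, mul_comm]

theorem card_grass_mul (k : ℕ) (hk : k ≤ finrank F V) :
    (Fintype.card (Grass F V k) : ℚ) * indepCount (Nat.card F) k k =
      indepCount (Nat.card F) (finrank F V) k := by
  have h := card_inf_finrank_eq (⊥ : Submodule F V) 0 k (by simpa using hk)
  have e₁ : {X : Grass F V (0 + k) // finrank F ↥(X.1 ⊓ ⊥) = 0} ≃ Grass F V k :=
    (Equiv.subtypeUnivEquiv fun X => by simp).trans (Equiv.cast (by rw [zero_add]))
  have e₂ : Fintype.card (Grass F (⊥ : Submodule F V) 0) = 1 := by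
    rw [Fintype.card_eq_one_iff]
    exact ⟨⟨⊥, by simp⟩, fun X => Subtype.ext (Subsingleton.elim _ _)⟩
  rw [Fintype.card_congr e₁, e₂] at h
  simpa using h

theorem card_grass (k : ℕ) (hk : k ≤ finrank F V) :
    (Fintype.card (Grass F V k) : ℚ) = gaussBinom (Nat.card F) (finrank F V) k := by
  have hq : 1 < Nat.card F := Finite.one_lt_card
  have hpos := indepCount_pos hq (le_refl k)
  have split : ∀ d, k ≤ d → indepCount (Nat.card F) d k =
      (∏ l ∈ Finset.range k, (Nat.card F : ℚ) ^ l) *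
        ∏ l ∈ Finset.range k, ((Nat.card F : ℚ) ^ (d - l) - 1) := by
    intro d hd
    rw [indepCount, ← Finset.prod_mul_distrib]
    refine Finset.prod_congr rfl fun l hl => ?_
    rw [mul_sub, ← pow_add, mul_one]
    have := Finset.mem_range.1 hl
    congr 2
    omega
  have reflect : ∏ l ∈ Finset.range k, ((Nat.card F : ℚ) ^ (k - l) - 1) =
      ∏ l ∈ Finset.range k, ((Nat.card F : ℚ) ^ (l + 1) - 1) := by
    rw [← Finset.prod_range_reflect]
    refine Finset.prod_congr rfl fun l hl => ?_
    have := Finset.mem_range.1 hl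
    congr 2
    omega
  have hP : (∏ l ∈ Finset.range k, (Nat.card F : ℚ) ^ l) ≠ 0 := by
    rw [Finset.prod_ne_zero_iff]
    intro l _
    have : (Nat.card F : ℚ) ≠ 0 := by exact_mod_cast (by omega : Nat.card F ≠ 0)
    exact pow_ne_zero _ this
  rw [eq_div_of_mul_eq hpos.ne' (card_grass_mul k hk), split _ hk, split _ le_rfl, reflect,
    mul_div_mul_left _ _ hP, gaussBinom]

end Counting

/-! ### A `p`-adic estimate -/

section Padic

theorem sum_range_min {s m : ℕ} (h : s ≤ m) :
    ∑ l ∈ Finset.range m, min s l = ∑ l ∈ Finset.range s, l + s * (m - s) := by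
  obtain ⟨d, rfl⟩ := Nat.exists_eq_add_of_le h
  rw [Finset.sum_range_add, Nat.add_sub_cancel_left]
  congr 1
  · exact Finset.sum_congr rfl fun l hl => min_eq_right (Finset.mem_range.1 hl).le
  · simp [mul_comm]

theorem sum_range_add_id (s d : ℕ) :
    ∑ l ∈ Finset.range (s + d), l = ∑ l ∈ Finset.range s, l + s * d + ∑ l ∈ Finset.range d, l := by
  rw [Finset.sum_range_add, Finset.sum_add_distrib]
  simp [mul_comm, add_assoc]

variable {p : ℕ} [Fact p.Prime] {q : ℕ}

theorem padicNorm_prod {ι : Type*} (S : Finset ι) (f : ι → ℚ) :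
    padicNorm p (∏ x ∈ S, f x) = ∏ x ∈ S, padicNorm p (f x) := by
  induction S using Finset.induction_on with
  | empty => simp
  | insert a S ha ih => rw [Finset.prod_insert ha, Finset.prod_insert ha, padicNorm.mul, ih]

theorem padicNorm_pow (x : ℚ) (m : ℕ) : padicNorm p (x ^ m) = padicNorm p x ^ m :=
  IsAbsoluteValue.abv_pow (padicNorm p) x m

theorem padicNorm_natCast_pos (hq : q ≠ 0) : 0 < padicNorm p q :=
  lt_of_le_of_ne (padicNorm.nonneg _) (padicNorm.nonzero (by exact_mod_cast hq)).symm

theorem padicNorm_one_sub_pow (hpq : p ∣ q) {m : ℕ} (hm : m ≠ 0) :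
    padicNorm p (1 - (q : ℚ) ^ m) = 1 := by
  have : padicNorm p ((1 - (q : ℤ) ^ m : ℤ) : ℚ) = 1 := by
    rw [padicNorm.int_eq_one_iff]
    intro h
    have h₁ : (p : ℤ) ∣ (q : ℤ) ^ m := dvd_pow (by exact_mod_cast hpq) hm
    have h₂ := dvd_add h h₁
    rw [sub_add_cancel] at h₂
    exact (Fact.out : p.Prime).one_lt.ne' (by exact_mod_cast Int.eq_one_of_dvd_one (by positivity) h₂)
  exact_mod_cast this

theorem padicNorm_pow_sub_pow (hpq : p ∣ q) {x y : ℕ} (hxy : x ≠ y) :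
    padicNorm p ((q : ℚ) ^ x - (q : ℚ) ^ y) = padicNorm p q ^ min x y := by
  have key : ∀ {x y : ℕ}, x < y →
      padicNorm p ((q : ℚ) ^ x - (q : ℚ) ^ y) = padicNorm p q ^ x := by
    intro x y h
    obtain ⟨d, rfl⟩ := Nat.exists_eq_add_of_lt h
    have : (q : ℚ) ^ x - (q : ℚ) ^ (x + d + 1) = (q : ℚ) ^ x * (1 - (q : ℚ) ^ (d + 1)) := by ring
    rw [this, padicNorm.mul, padicNorm_one_sub_pow hpq (by omega), mul_one, padicNorm_pow]
  rcases lt_or_gt_of_ne hxy with h | h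
  · rw [key h, min_eq_left h.le]
  · rw [← padicNorm.neg, neg_sub, key h, min_eq_right h.le]

theorem padicNorm_qRoots_eval (hpq : p ∣ q) {S : Finset ℕ} {x : ℕ} (hx : x ∉ S) :
    padicNorm p ((qRoots q S).eval ((q : ℚ) ^ x)) = padicNorm p q ^ ∑ l ∈ S, min x l := by
  rw [qRoots_eval, padicNorm_prod, ← Finset.prod_pow_eq_pow_sum]
  refine Finset.prod_congr rfl fun l hl => padicNorm_pow_sub_pow hpq ?_
  rintro rfl
  exact hx hl

theorem qRoots_erase_zero_eval (q t : ℕ) (x : ℚ) :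
    (qRoots q ((Finset.range (t + 1)).erase 0)).eval x =
      ∏ l ∈ Finset.range t, (x - (q : ℚ) ^ (l + 1)) := by
  rw [qRoots_eval]
  symm
  refine Finset.prod_nbij (fun l => l + 1) (fun l hl => by simpa using hl)
    (fun a _ b _ h => Nat.succ_injective h) (fun l hl => ?_) (fun _ _ => rfl)
  obtain ⟨h₁, h₂⟩ := Finset.mem_erase.1 (Finset.mem_coe.1 hl)
  have := Finset.mem_range.1 h₂
  exact ⟨l - 1, by simp; omega, by simp; omega⟩

/-- The increment of `(x - q) ⋯ (x - q ^ t)` between `q ^ j` and `q ^ (j + 1)`. Both values have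
the norm of `q ^ (1 + ⋯ + t)`, but they agree to a higher order. -/
theorem padicNorm_qRoots_erase_zero_increment (hpq : p ∣ q) {t j : ℕ} (ht : 1 ≤ t) (htj : t ≤ j) :
    padicNorm p ((qRoots q ((Finset.range (t + 1)).erase 0)).eval ((q : ℚ) ^ (j + 1)) -
        (qRoots q ((Finset.range (t + 1)).erase 0)).eval ((q : ℚ) ^ j)) =
      padicNorm p q ^ (∑ l ∈ Finset.range t, l + j) := by
  obtain ⟨t, rfl⟩ := Nat.exists_eq_add_of_le' ht
  rw [qRoots_erase_zero_eval, qRoots_erase_zero_eval]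
  have e₁ : ∏ l ∈ Finset.range (t + 1), ((q : ℚ) ^ (j + 1) - (q : ℚ) ^ (l + 1)) =
      (q : ℚ) ^ (t + 1) * (((q : ℚ) ^ j - 1) *
        ∏ l ∈ Finset.range t, ((q : ℚ) ^ j - (q : ℚ) ^ (l + 1))) := by
    have : ∀ l, (q : ℚ) ^ (j + 1) - (q : ℚ) ^ (l + 1) = q * ((q : ℚ) ^ j - (q : ℚ) ^ l) :=
      fun l => by ring
    simp_rw [this]
    rw [Finset.prod_mul_distrib, Finset.prod_const, Finset.card_range, Finset.prod_range_succ']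
    ring
  rw [e₁, Finset.prod_range_succ]
  have e₂ : ∀ Q : ℚ, (q : ℚ) ^ (t + 1) * (((q : ℚ) ^ j - 1) * Q) - Q *
      ((q : ℚ) ^ j - (q : ℚ) ^ (t + 1)) = -(Q * (q : ℚ) ^ j * (1 - (q : ℚ) ^ (t + 1))) := fun Q => by ring
  rw [e₂, padicNorm.neg, padicNorm.mul, padicNorm_one_sub_pow hpq (by omega), mul_one, padicNorm.mul,
    padicNorm_pow, pow_add, padicNorm_prod, Finset.sum_range_succ', add_zero,
    ← Finset.prod_pow_eq_pow_sum]
  congr 1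
  refine Finset.prod_congr rfl fun l hl => ?_
  have := Finset.mem_range.1 hl
  rw [padicNorm_pow_sub_pow hpq (by omega), min_eq_right (by omega)]

/-- Let `H` be orthogonal to the polynomials of degree less than `i` on the nodes
`q ^ 0, …, q ^ i`, and let `δ` be orthogonal to the polynomials of degree at most `t` on these
nodes, with `δ i = 1`, `δ (i - 1) = -1` and no other mass above `t`. If `∑ s, δ s * H s / N s`
vanishes, for weights `N s` with the norm of `q ^ ((i - s) * (k - s))`, then `H i = 0`.
Otherwise the norms of all terms would be known, and the term for `s = 0` would have a norm
strictly larger than all the others. -/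
theorem eq_zero_of_sum_mul_div_eq_zero (hpq : p ∣ q) (hq : q ≠ 0) {i k t : ℕ} (ht : 1 ≤ t)
    (hti : t + 2 ≤ i) (hik : i ≤ k) {H N δ : ℕ → ℚ}
    (hH : ∀ s < i, H s * (qRoots q ((Finset.range i).erase s)).eval ((q : ℚ) ^ s) +
      H i * (qRoots q ((Finset.range i).erase s)).eval ((q : ℚ) ^ i) = 0)
    (hδ : ∀ s < t + 1, δ s * (qRoots q ((Finset.range (t + 1)).erase s)).eval ((q : ℚ) ^ s) +
      (qRoots q ((Finset.range (t + 1)).erase s)).eval ((q : ℚ) ^ i) -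
      (qRoots q ((Finset.range (t + 1)).erase s)).eval ((q : ℚ) ^ (i - 1)) = 0)
    (hN : ∀ s ≤ i, padicNorm p (N s) = padicNorm p q ^ ((i - s) * (k - s)))
    (hsum : ∑ s ∈ Finset.range (t + 1), δ s * H s / N s +
      ((-1) * H (i - 1) / N (i - 1) + 1 * H i / N i) = 0) : H i = 0 := by
  by_contra hne
  set θ := padicNorm p q with hθ
  have θpos : 0 < θ := padicNorm_natCast_pos hq
  have θlt : θ < 1 := (padicNorm.nat_lt_one_iff q).2 hpq
  set c := padicNorm p (H i) with hc
  have cpos : 0 < c := lt_of_le_of_ne (padicNorm.nonneg _) (padicNorm.nonzero hne).symm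
  have sum_erase : ∀ {m s x : ℕ}, s < m → ∑ l ∈ (Finset.range m).erase s, min x l + min x s =
      ∑ l ∈ Finset.range m, min x l := fun h => Finset.sum_erase_add _ _ (Finset.mem_range.2 h)
  have sum_full : ∀ {m x : ℕ}, m ≤ x + 1 → ∑ l ∈ Finset.range m, min x l =
      ∑ l ∈ Finset.range m, l := fun h => Finset.sum_congr rfl fun l hl =>
        min_eq_right (by have := Finset.mem_range.1 hl; omega)
  have gauss := fun m => Finset.sum_range_id_mul_two m
  -- the norm of `H s`
  have normH : ∀ s ≤ i, padicNorm p (H s) = c * θ ^ ∑ l ∈ Finset.range (i - s), l := by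
    intro s hs
    rcases hs.lt_or_eq with hs | rfl
    · have h := congrArg (padicNorm p) (eq_neg_of_add_eq_zero_left (hH s hs))
      rw [padicNorm.neg, padicNorm.mul, padicNorm.mul,
        padicNorm_qRoots_eval hpq (Finset.notMem_erase _ _),
        padicNorm_qRoots_eval hpq (by simp), ← hθ, ← hc] at h
      have hexp : ∑ l ∈ (Finset.range i).erase s, min i l =
          ∑ l ∈ Finset.range (i - s), l + ∑ l ∈ (Finset.range i).erase s, min s l := by
        have h₁ := sum_erase (x := i) hs
        have h₂ := sum_erase (x := s) hs
        rw [sum_full (by omega), min_eq_right hs.le] at h₁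
        rw [sum_range_min hs.le, min_self] at h₂
        have h₃ := sum_range_add_id s (i - s)
        rw [Nat.add_sub_cancel' hs.le] at h₃
        omega
      rw [hexp, pow_add, ← mul_assoc] at h
      exact mul_right_cancel₀ (pow_pos θpos _).ne' h
    · simp [hc]
  -- the norm of `δ 0`, and a bound on the norms of the other `δ s`
  have normδ₀ : padicNorm p (δ 0) = θ ^ (∑ l ∈ Finset.range t, l + (i - 1)) := by
    have h := hδ 0 (by omega)
    rw [add_sub_assoc] at h
    have h := congrArg (padicNorm p) (eq_neg_of_add_eq_zero_left h)
    have hi : i = (i - 1) + 1 := by omega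
    rw [padicNorm.neg, padicNorm.mul, padicNorm_qRoots_eval hpq (Finset.notMem_erase _ _)] at h
    rw [hi, Nat.add_sub_cancel,
      padicNorm_qRoots_erase_zero_increment hpq ht (by omega : t ≤ i - 1)] at h
    simpa using h
  have normδ : ∀ s < t + 1, padicNorm p (δ s) * θ ^ ∑ l ∈ (Finset.range (t + 1)).erase s, min s l ≤
      θ ^ ∑ l ∈ (Finset.range (t + 1)).erase s, l := by
    intro s hs
    have h := hδ s hs
    rw [add_sub_assoc] at h
    have h := congrArg (padicNorm p) (eq_neg_of_add_eq_zero_left h)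
    rw [padicNorm.neg, padicNorm.mul, padicNorm_qRoots_eval hpq (Finset.notMem_erase _ _)] at h
    rw [h]
    have hmin : ∀ x, t ≤ x → ∑ l ∈ (Finset.range (t + 1)).erase s, min x l =
        ∑ l ∈ (Finset.range (t + 1)).erase s, l := fun x hx =>
      Finset.sum_congr rfl fun l hl => min_eq_right (by
        have := Finset.mem_range.1 (Finset.mem_of_mem_erase hl)
        omega)
    refine padicNorm.sub.trans (max_le ?_ ?_)
    · rw [padicNorm_qRoots_eval hpq (by simp; omega), hmin _ (by omega)]
    · rw [padicNorm_qRoots_eval hpq (by simp; omega), hmin _ (by omega)]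
  -- comparison of a term with the term for `s = 0`
  set E := ∑ l ∈ Finset.range t, l + (i - 1) + ∑ l ∈ Finset.range i, l with hE
  have norm₀ : padicNorm p (δ 0 * H 0 / N 0) = c * θ ^ E / θ ^ (i * k) := by
    rw [padicNorm.div, padicNorm.mul, normδ₀, normH 0 (by omega), hN 0 (by omega), hE, pow_add,
      Nat.sub_zero, Nat.sub_zero]
    ring
  have compare : ∀ (x : ℚ) (s a b : ℕ), s ≤ i → padicNorm p x * θ ^ a ≤ θ ^ b →
      E + (i - s) * (k - s) + a < b + ∑ l ∈ Finset.range (i - s), l + i * k →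
      padicNorm p (x * H s / N s) < padicNorm p (δ 0 * H 0 / N 0) := by
    intro x s a b hs hx hlt
    rw [norm₀, padicNorm.div, padicNorm.mul, normH s hs, hN s hs,
      div_lt_div_iff₀ (pow_pos θpos _) (pow_pos θpos _)]
    refine lt_of_mul_lt_mul_right ?_ (pow_pos θpos a).le
    calc padicNorm p x * (c * θ ^ ∑ l ∈ Finset.range (i - s), l) * θ ^ (i * k) * θ ^ a
        = c * (padicNorm p x * θ ^ a) * θ ^ (∑ l ∈ Finset.range (i - s), l + i * k) := by
          rw [pow_add]; ring
      _ ≤ c * θ ^ b * θ ^ (∑ l ∈ Finset.range (i - s), l + i * k) := by gcongr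
      _ = c * θ ^ (b + ∑ l ∈ Finset.range (i - s), l + i * k) := by
          rw [add_assoc, pow_add θ b]; ring
      _ < c * θ ^ (E + (i - s) * (k - s) + a) :=
          mul_lt_mul_of_pos_left (pow_lt_pow_right_of_lt_one₀ θpos θlt hlt) cpos
      _ = c * θ ^ E * θ ^ ((i - s) * (k - s)) * θ ^ a := by
          rw [pow_add, pow_add]; ring
  have gt := gauss t
  have gi := gauss i
  have hmid : ∀ s ∈ Finset.range t, padicNorm p (δ (s + 1) * H (s + 1) / N (s + 1)) <
      padicNorm p (δ 0 * H 0 / N 0) := by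
    intro s hs
    have hs := Finset.mem_range.1 hs
    refine compare _ _ _ _ (by omega) (normδ (s + 1) (by omega)) ?_
    have h₁ := sum_erase (m := t + 1) (s := s + 1) (x := s + 1) (by omega)
    have h₂ := Finset.sum_erase_add (Finset.range (t + 1)) (fun l => l)
      (Finset.mem_range.2 (by omega : s + 1 < t + 1))
    rw [sum_range_min (by omega), min_self] at h₁
    rw [Finset.sum_range_succ] at h₂
    have h₃ := sum_range_add_id (s + 1) (i - (s + 1))
    rw [Nat.add_sub_cancel' (by omega)] at h₃
    have h₄ := gauss (s + 1)
    obtain ⟨u, rfl⟩ := Nat.exists_eq_add_of_lt hs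
    obtain ⟨v, rfl⟩ := Nat.exists_eq_add_of_le hti
    obtain ⟨w, rfl⟩ := Nat.exists_eq_add_of_le hik
    simp only [show s + u + 1 + 2 + v - (s + 1) = u + 2 + v by omega,
      show s + u + 1 + 2 + v + w - (s + 1) = u + 2 + v + w by omega,
      show s + u + 1 + 1 - (s + 1) = u + 1 by omega, Nat.add_sub_cancel,
      show s + u + 1 + 2 + v - 1 = s + u + 2 + v by omega] at *
    nlinarith
  have hlast : padicNorm p (1 * H i / N i) < padicNorm p (δ 0 * H 0 / N 0) := by
    refine compare 1 i 0 0 le_rfl (by simp) ?_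
    obtain ⟨v, rfl⟩ := Nat.exists_eq_add_of_le hti
    obtain ⟨w, rfl⟩ := Nat.exists_eq_add_of_le hik
    obtain ⟨t, rfl⟩ := Nat.exists_eq_add_of_le' ht
    simp only [show t + 1 + 2 + v - 1 = t + 2 + v by omega, Nat.sub_self, Nat.add_sub_cancel,
      Finset.range_zero, Finset.sum_empty] at *
    nlinarith
  have hlast' : padicNorm p ((-1) * H (i - 1) / N (i - 1)) < padicNorm p (δ 0 * H 0 / N 0) := by
    refine compare (-1) (i - 1) 0 0 (by omega) (by simp) ?_
    obtain ⟨v, rfl⟩ := Nat.exists_eq_add_of_le hti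
    obtain ⟨w, rfl⟩ := Nat.exists_eq_add_of_le hik
    obtain ⟨t, rfl⟩ := Nat.exists_eq_add_of_le' ht
    simp only [show t + 1 + 2 + v - 1 = t + 2 + v by omega,
      show t + 1 + 2 + v - (t + 2 + v) = 1 by omega,
      show t + 1 + 2 + v + w - (t + 2 + v) = 1 + w by omega, Nat.add_sub_cancel,
      Finset.range_one, Finset.sum_singleton] at *
    nlinarith
  rw [Finset.sum_range_succ', add_right_comm] at hsum
  have hpos : 0 < padicNorm p (δ 0 * H 0 / N 0) := (padicNorm.nonneg _).trans_lt hlast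
  have h := congrArg (padicNorm p) (eq_neg_of_add_eq_zero_right hsum)
  rw [padicNorm.neg] at h
  refine h.not_gt (padicNorm.nonarchimedean.trans_lt (max_lt ?_
    (padicNorm.nonarchimedean.trans_lt (max_lt hlast' hlast))))
  exact padicNorm.sum_lt' hmid hpos

end Padic

/-! ### Distribution of a function with respect to a fixed subspace -/

section Layers

variable {F V : Type*} [Field F] [AddCommGroup V] [Module F V] [Finite V] {k t : ℕ}

/-- The sum of `u` over the `k`-dimensional subspaces that meet `Z` in dimension `s`. -/
noncomputable def layer (Z : Submodule F V) (u : Grass F V k → ℚ) (s : ℕ) : ℚ :=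
  ∑ X : Grass F V k, if finrank F ↥(X.1 ⊓ Z) = s then u X else 0

theorem sum_mul_finrank_inf_eq (Z : Submodule F V) (u : Grass F V k → ℚ) (f : ℕ → ℚ) :
    ∑ X : Grass F V k, u X * f (finrank F ↥(X.1 ⊓ Z)) =
      ∑ s ∈ Finset.range (finrank F Z + 1), layer Z u s * f s := by
  simp_rw [layer, Finset.sum_mul]
  rw [Finset.sum_comm]
  refine Finset.sum_congr rfl fun X _ => ?_
  have hX : finrank F ↥(X.1 ⊓ Z) ∈ Finset.range (finrank F Z + 1) :=
    Finset.mem_range.2 (Nat.lt_succ_of_le (Submodule.finrank_mono inf_le_right))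
  rw [Finset.sum_eq_single_of_mem _ hX fun s _ hs => by rw [if_neg hs.symm, zero_mul], if_pos rfl]

theorem layer_one_eq_card (Z : Submodule F V) (s : ℕ) :
    layer Z (1 : Grass F V k → ℚ) s =
      Fintype.card {X : Grass F V k // finrank F ↥(X.1 ⊓ Z) = s} := by
  rw [Fintype.card_subtype, layer]
  simp

theorem layer_one_nonneg (Z : Submodule F V) (s : ℕ) :
    0 ≤ layer Z (1 : Grass F V k → ℚ) s := by
  rw [layer_one_eq_card]
  positivity

theorem exists_finrank_inf_eq_of_layer_one_ne_zero {Z : Submodule F V} {s : ℕ}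
    (h : layer Z (1 : Grass F V k → ℚ) s ≠ 0) :
    ∃ X : Grass F V k, finrank F ↥(X.1 ⊓ Z) = s := by
  by_contra! hne
  exact h (Finset.sum_eq_zero fun X _ => if_neg (hne X))

theorem layer_last {i : ℕ} (Z : Grass F V i) (h : Grass F V k → ℚ) :
    layer Z.1 h i = upSum i h Z := by
  rw [layer, upSum_apply]
  refine Finset.sum_congr rfl fun X _ => ?_
  have : finrank F ↥(X.1 ⊓ Z.1) = i ↔ Z.1 ≤ X.1 := by
    constructor
    · intro hX
      exact inf_eq_right.1 (Submodule.eq_of_le_of_finrank_eq inf_le_right (hX.trans Z.2.symm))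
    · intro hX
      rw [inf_eq_right.2 hX, Z.2]
  simp only [this]

instance : Finite (V ≃ₗ[F] V) := Finite.of_injective _ DFunLike.coe_injective

/-- Averaging over the stabilizer of `Z`, which acts transitively on the `k`-dimensional subspaces
meeting `Z` in a given dimension, replaces `h` by its mean values on the layers of `Z`. If all
translates of `h` have the same scalar product `C` with `u`, then so has this average. -/
theorem sum_layer_mul_layer_div_eq (Z : Submodule F V) {u h : Grass F V k → ℚ} {C : ℚ}
    (hC : ∀ g : V ≃ₗ[F] V, ∑ X, u X * h (grassMap g k X) = C) :
    ∑ s ∈ Finset.range (finrank F Z + 1),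
      layer Z u s * (layer Z h s / layer Z (1 : Grass F V k → ℚ) s) = C := by
  let G := {g : V ≃ₗ[F] V // Z.map (g : V →ₗ[F] V) = Z}
  have : Fintype G := Fintype.ofFinite G
  have : Nonempty G := ⟨⟨LinearEquiv.refl F V, Submodule.map_id Z⟩⟩
  have hG : (Fintype.card G : ℚ) ≠ 0 := by exact_mod_cast Fintype.card_ne_zero
  have hdim : ∀ (g : G) (X : Grass F V k),
      finrank F ↥((grassMap g.1 k X).1 ⊓ Z) = finrank F ↥(X.1 ⊓ Z) := by
    intro g X
    have := finrank_map_inf_map g.1 X.1 Z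
    rwa [g.2] at this
  let avg : Grass F V k → ℚ := fun X => ∑ g : G, h (grassMap g.1 k X)
  have avg_eq : ∀ X Y : Grass F V k, finrank F ↥(Y.1 ⊓ Z) = finrank F ↥(X.1 ⊓ Z) →
      avg Y = avg X := by
    intro X Y hXY
    obtain ⟨g₀, h₁, h₂⟩ := exists_linearEquiv_map_eq (X.2.trans Y.2.symm) rfl hXY.symm
    have h₂' : Z.map (g₀.symm : V →ₗ[F] V) = Z := by
      nth_rewrite 1 [← h₂]
      rw [← Submodule.map_comp, LinearEquiv.symm_comp, Submodule.map_id]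
    let e : G ≃ G :=
      { toFun := fun g => ⟨g₀.trans g.1, by
          rw [LinearEquiv.coe_trans, Submodule.map_comp, h₂, g.2]⟩
        invFun := fun g => ⟨g₀.symm.trans g.1, by
          rw [LinearEquiv.coe_trans, Submodule.map_comp, h₂', g.2]⟩
        left_inv := fun g => Subtype.ext (by ext x; simp)
        right_inv := fun g => Subtype.ext (by ext x; simp) }
    change ∑ g : G, h (grassMap g.1 k Y) = ∑ g : G, h (grassMap g.1 k X)
    refine Eq.trans ?_ (e.sum_comp _)
    refine Finset.sum_congr rfl fun g _ => congrArg h (Subtype.ext ?_)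
    change Y.1.map (g.1 : V →ₗ[F] V) = X.1.map ((g₀.trans g.1 : V ≃ₗ[F] V) : V →ₗ[F] V)
    rw [LinearEquiv.coe_trans, Submodule.map_comp, h₁]
  have avg_mul : ∀ X : Grass F V k, avg X = Fintype.card G *
      (layer Z h (finrank F ↥(X.1 ⊓ Z)) / layer Z (1 : Grass F V k → ℚ) (finrank F ↥(X.1 ⊓ Z))) := by
    intro X
    have hN : layer Z (1 : Grass F V k → ℚ) (finrank F ↥(X.1 ⊓ Z)) ≠ 0 := by
      rw [layer_one_eq_card]
      have : Nonempty {Y : Grass F V k // finrank F ↥(Y.1 ⊓ Z) = finrank F ↥(X.1 ⊓ Z)} := ⟨⟨X, rfl⟩⟩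
      exact_mod_cast Fintype.card_ne_zero
    rw [mul_div_assoc', eq_div_iff hN]
    calc avg X * layer Z (1 : Grass F V k → ℚ) (finrank F ↥(X.1 ⊓ Z))
        = ∑ Y : Grass F V k, if finrank F ↥(Y.1 ⊓ Z) = finrank F ↥(X.1 ⊓ Z) then avg Y else 0 := by
          rw [layer, Finset.mul_sum]
          refine Finset.sum_congr rfl fun Y _ => ?_
          split_ifs with hY
          · rw [avg_eq X Y hY]; simp
          · simp
      _ = ∑ g : G, ∑ Y : Grass F V k,
            if finrank F ↥(Y.1 ⊓ Z) = finrank F ↥(X.1 ⊓ Z) then h (grassMap g.1 k Y) else 0 := by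
          rw [Finset.sum_comm]
          refine Finset.sum_congr rfl fun Y _ => ?_
          split_ifs <;> simp [avg]
      _ = ∑ g : G, layer Z h (finrank F ↥(X.1 ⊓ Z)) := by
          refine Finset.sum_congr rfl fun g _ => ?_
          rw [layer, ← (grassMap g.1 k).sum_comp fun Y =>
            if finrank F ↥(Y.1 ⊓ Z) = finrank F ↥(X.1 ⊓ Z) then h Y else 0]
          simp_rw [hdim]
      _ = Fintype.card G * layer Z h (finrank F ↥(X.1 ⊓ Z)) := by simp
  apply mul_left_cancel₀ hG
  rw [← sum_mul_finrank_inf_eq Z u fun s => layer Z h s / layer Z (1 : Grass F V k → ℚ) s]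
  calc (Fintype.card G : ℚ) * ∑ X, u X * (layer Z h (finrank F ↥(X.1 ⊓ Z)) /
        layer Z (1 : Grass F V k → ℚ) (finrank F ↥(X.1 ⊓ Z))) = ∑ X, u X * avg X := by
        rw [Finset.mul_sum]
        refine Finset.sum_congr rfl fun X _ => ?_
        rw [avg_mul]
        ring
    _ = ∑ g : G, ∑ X, u X * h (grassMap g.1 k X) := by
        simp_rw [avg, Finset.mul_sum]
        exact Finset.sum_comm
    _ = Fintype.card G * C := by simp [hC]

variable [Finite F]

theorem padicNorm_indepCount {p q : ℕ} [Fact p.Prime] (hpq : p ∣ q) {d m : ℕ} (h : m ≤ d) :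
    padicNorm p (indepCount q d m) = padicNorm p q ^ ∑ l ∈ Finset.range m, l := by
  rw [indepCount, padicNorm_prod, ← Finset.prod_pow_eq_pow_sum]
  refine Finset.prod_congr rfl fun l hl => ?_
  have := Finset.mem_range.1 hl
  rw [padicNorm_pow_sub_pow hpq (by omega), min_eq_right (by omega)]

theorem padicNorm_card_grass {p : ℕ} [Fact p.Prime] (hpq : p ∣ Nat.card F) {s : ℕ}
    (hs : s ≤ finrank F V) : padicNorm p (Fintype.card (Grass F V s)) = 1 := by
  have h := congrArg (padicNorm p) (card_grass_mul s hs)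
  rw [padicNorm.mul, padicNorm_indepCount hpq le_rfl, padicNorm_indepCount hpq hs] at h
  exact (mul_eq_right₀ (pow_pos (padicNorm_natCast_pos Nat.card_pos.ne') _).ne').1 h

theorem padicNorm_layer_one {p : ℕ} [Fact p.Prime] (hpq : p ∣ Nat.card F) (Z : Submodule F V) {s : ℕ}
    (hs : s ≤ finrank F Z) (hsk : s ≤ k) (hk : k + finrank F Z ≤ finrank F V + s) :
    padicNorm p (layer Z (1 : Grass F V k → ℚ) s) =
      padicNorm p (Nat.card F) ^ ((finrank F Z - s) * (k - s)) := by
  obtain ⟨m, rfl⟩ := Nat.exists_eq_add_of_le hsk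
  have hθ := padicNorm_natCast_pos (p := p) (Nat.card_pos (α := F)).ne'
  have h := congrArg (padicNorm p) (card_inf_finrank_eq Z s m (by omega))
  rw [padicNorm.mul, padicNorm.mul, padicNorm.mul, padicNorm.mul, padicNorm_pow, padicNorm_pow,
    padicNorm_card_grass hpq hs, padicNorm_indepCount hpq le_rfl,
    padicNorm_indepCount hpq (by omega), ← mul_assoc, ← mul_assoc, one_mul] at h
  have h := mul_right_cancel₀ (pow_pos hθ _).ne' h
  rw [layer_one_eq_card, Nat.add_sub_cancel_left]
  apply mul_right_cancel₀ (pow_pos hθ (s * m)).ne'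
  rw [h, ← pow_add, ← Nat.add_mul, Nat.sub_add_cancel hs]

end Layers

/-! ### Steiner systems -/

section Steiner

/-- Every `t`-dimensional subspace is contained in exactly one element of `B`. -/
def IsSteiner {F V : Type*} [Field F] [AddCommGroup V] [Module F V] {k : ℕ} (t : ℕ)
    (B : Set (Grass F V k)) : Prop :=
  ∀ T : Grass F V t, ∃! X : Grass F V k, X ∈ B ∧ T.1 ≤ X.1

variable {F V : Type*} [Field F] [AddCommGroup V] [Module F V] {k t : ℕ} {B : Set (Grass F V k)}

theorem IsSteiner.preimage (hB : IsSteiner t B) (g : V ≃ₗ[F] V) :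
    IsSteiner t (grassMap g k ⁻¹' B) := by
  intro T
  obtain ⟨X, ⟨hX, hTX⟩, huniq⟩ := hB (grassMap g t T)
  have hle : ∀ Y : Grass F V k, (grassMap g t T).1 ≤ (grassMap g k Y).1 ↔ T.1 ≤ Y.1 := fun Y =>
    map_le_map_equiv_iff g
  obtain ⟨X, rfl⟩ := (grassMap g k).surjective X
  refine ⟨X, ⟨hX, (hle X).1 hTX⟩, fun Y hY => ?_⟩
  exact (grassMap g k).injective (huniq _ ⟨hY.1, (hle Y).2 hY.2⟩)

variable [Finite V]

theorem IsSteiner.upSum_indicator (hB : IsSteiner t B) :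
    upSum t (B.indicator (1 : Grass F V k → ℚ)) = 1 := by
  ext T
  obtain ⟨X, ⟨hX, hTX⟩, huniq⟩ := hB T
  rw [upSum_apply, Finset.sum_eq_single X]
  · simp [hX, hTX]
  · intro Y _ hY
    split_ifs with hTY
    · exact Set.indicator_of_notMem (fun hYB => hY (huniq Y ⟨hYB, hTY⟩)) _
    · rfl
  · simp

theorem IsSteiner.finrank_inf_lt (hB : IsSteiner t B) {X Y : Grass F V k} (hX : X ∈ B) (hY : Y ∈ B)
    (hne : X ≠ Y) : finrank F ↥(X.1 ⊓ Y.1) < t := by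
  by_contra! h
  obtain ⟨T, -, hT, hTt⟩ := exists_between_finrank_eq (R := ⊥) (X := X.1 ⊓ Y.1) (a := t) bot_le
    (by simp) h
  exact hne ((hB ⟨T, hTt⟩).unique ⟨hX, hT.trans inf_le_left⟩ ⟨hY, hT.trans inf_le_right⟩)

theorem IsSteiner.nonempty (hB : IsSteiner t B) (ht : t ≤ finrank F V) : B.Nonempty := by
  obtain ⟨T, -, -, hT⟩ := exists_between_finrank_eq (R := ⊥) (X := (⊤ : Submodule F V)) (a := t)
    bot_le (by simp) (by simpa using ht)
  obtain ⟨X, hX, -⟩ := hB ⟨T, hT⟩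
  exact ⟨X, hX.1⟩

/-- Any `k`-dimensional subspace is a block of some translate of a given Steiner system. -/
theorem IsSteiner.exists_mem (hB : IsSteiner t B) (ht : t ≤ finrank F V) (X : Grass F V k) :
    ∃ B' : Set (Grass F V k), IsSteiner t B' ∧ X ∈ B' := by
  obtain ⟨X₀, hX₀⟩ := hB.nonempty ht
  obtain ⟨g, hg, -⟩ := exists_linearEquiv_map_eq (X := X.1) (X' := X₀.1) (Z := ⊤) (Z' := ⊤)
    (X.2.trans X₀.2.symm) rfl (by rw [inf_top_eq, inf_top_eq, X.2, X₀.2])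
  refine ⟨_, hB.preimage g, ?_⟩
  have : grassMap g k X = X₀ := Subtype.ext hg
  rwa [Set.mem_preimage, this]

/-- If a block `X` meets `Z` in at least a hyperplane of `Z`, then all other blocks meet `Z` in
dimension at most `t`. -/
theorem IsSteiner.layer_indicator (hB : IsSteiner t B) {X : Grass F V k} (hX : X ∈ B)
    {Z : Submodule F V} (hZ : finrank F Z ≤ finrank F ↥(X.1 ⊓ Z) + 1) {s : ℕ} (hs : t < s) :
    layer Z (B.indicator (1 : Grass F V k → ℚ)) s = if finrank F ↥(X.1 ⊓ Z) = s then 1 else 0 := by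
  rw [layer, Finset.sum_eq_single X]
  · simp [hX]
  · intro Y _ hY
    split_ifs with hYs
    · refine Set.indicator_of_notMem (fun hYB => ?_) _
      have h₁ := hB.finrank_inf_lt hYB hX hY
      have h₂ := Submodule.finrank_sup_add_finrank_inf_eq (Y.1 ⊓ Z) (X.1 ⊓ Z)
      have h₃ : finrank F ↥(Y.1 ⊓ Z ⊔ X.1 ⊓ Z) ≤ finrank F Z :=
        Submodule.finrank_mono (sup_le inf_le_right inf_le_right)
      have h₄ : finrank F ↥((Y.1 ⊓ Z) ⊓ (X.1 ⊓ Z)) ≤ finrank F ↥(Y.1 ⊓ X.1) :=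
        Submodule.finrank_mono (inf_le_inf inf_le_left inf_le_left)
      omega
    · rfl
  · simp

theorem upSum_self (h : Grass F V k → ℚ) : upSum k h = h := by
  ext X
  rw [upSum_apply, Finset.sum_eq_single X]
  · simp
  · intro Y _ hY
    refine if_neg fun hle => hY (Subtype.ext ?_)
    exact (Submodule.eq_of_le_of_finrank_eq hle (X.2.trans Y.2.symm)).symm
  · simp

variable [Finite F]

/-- If `n ≤ t + k`, Kantor's theorem shows that the characteristic vector of a Steiner system is
constant, so that all `k`-dimensional subspaces are blocks. -/
theorem IsSteiner.add_lt_finrank (hB : IsSteiner t B) (htk : t < k) (hk : k < finrank F V) :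
    k + t < finrank F V := by
  by_contra! hle
  obtain ⟨κ, hκ⟩ := exists_upSum_eq_of_le (F := F) (V := V) htk.le (le_refl k)
  have h₁ : ∀ T : Grass F V t, upSum t (1 : Grass F V k → ℚ) T = κ := fun T => by
    rw [hκ 1 1 (fun X => by rw [upSum_self]; rfl) T, one_mul]
  have h₀ : κ • B.indicator (1 : Grass F V k → ℚ) - 1 = 0 := by
    refine eq_zero_of_upSum_eq_zero htk.le (by omega) (a := t) ?_
    ext T
    rw [map_sub, map_smul, hB.upSum_indicator, Pi.sub_apply, h₁]
    simp
  have hall : ∀ X : Grass F V k, X ∈ B := by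
    intro X
    by_contra hX
    have := congrFun h₀ X
    simp [hX] at this
  obtain ⟨X, hX⟩ := hB.nonempty (by omega)
  obtain ⟨v, hv⟩ : ∃ v, v ∉ X.1 := by
    by_contra! h
    have := X.2
    rw [(Submodule.eq_top_iff').2 h, finrank_top] at this
    omega
  obtain ⟨S, -, hSX, hS⟩ := exists_between_finrank_eq (R := ⊥) (X := X.1) (a := k - 1) bot_le
    (by simp) (by rw [X.2]; omega)
  have hv0 : v ≠ 0 := fun h => hv (h ▸ X.1.zero_mem)
  have hd : Disjoint S (Submodule.span F {v}) := by
    rw [Submodule.disjoint_span_singleton' hv0]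
    exact fun h => hv (hSX h)
  let Y : Grass F V k := ⟨S ⊔ Submodule.span F {v}, by
    rw [finrank_sup_of_disjoint hd, hS, finrank_span_singleton hv0]
    omega⟩
  have hvY : v ∈ Y.1 := (le_sup_right : _ ≤ Y.1) (Submodule.mem_span_singleton_self v)
  have h₂ := hB.finrank_inf_lt (hall X) (hall Y) (fun h => hv (by rw [h]; exact hvY))
  have h₃ : finrank F S ≤ finrank F ↥(X.1 ⊓ Y.1) := Submodule.finrank_mono (le_inf hSX le_sup_left)
  omega

theorem sum_range_mul_qRoots_erase (q : ℕ) (u : ℕ → ℚ) {m s : ℕ} (hs : s < m) :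
    ∑ l ∈ Finset.range m, u l * (qRoots q ((Finset.range m).erase s)).eval ((q : ℚ) ^ l) =
      u s * (qRoots q ((Finset.range m).erase s)).eval ((q : ℚ) ^ s) := by
  refine Finset.sum_eq_single_of_mem s (Finset.mem_range.2 hs) fun l hl hls => ?_
  rw [qRoots_eval_eq_zero q (Finset.mem_erase.2 ⟨hls, hl⟩), mul_zero]

theorem natDegree_qRoots_erase (q : ℕ) {m s : ℕ} (hs : s < m) :
    (qRoots q ((Finset.range m).erase s)).natDegree = m - 1 := by
  rw [qRoots_natDegree, Finset.card_erase_of_mem (Finset.mem_range.2 hs), Finset.card_range]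

/-- If `h` has the same sum over all Steiner systems and vanishing sums over the `k`-spaces
containing an `(i - 1)`-space, then it has vanishing sums over the `k`-spaces containing an
`i`-space, provided that `t < i ≤ min k (n - k)`. -/
theorem upSum_eq_zero_of_sum_indicator_eq (hB : IsSteiner t B) (ht : 1 ≤ t) {i : ℕ} (hti : t < i)
    (hik : i ≤ k) (hin : k + i ≤ finrank F V) {h : Grass F V k → ℚ} (hh : upSum (i - 1) h = 0)
    {C : ℚ} (hC : ∀ B : Set (Grass F V k), IsSteiner t B →
      ∑ X, B.indicator (1 : Grass F V k → ℚ) X * h X = C) :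
    upSum i h = 0 := by
  ext Z
  rw [← layer_last, Pi.zero_apply]
  have hZ : finrank F Z.1 = i := Z.2
  set q := Nat.card F with hq
  have hq1 : 1 < q := Finite.one_lt_card
  have : Fact q.minFac.Prime := ⟨Nat.minFac_prime hq1.ne'⟩
  have hpq : q.minFac ∣ q := Nat.minFac_dvd q
  set H := layer Z.1 h with hH
  set N := layer Z.1 (1 : Grass F V k → ℚ) with hN
  have normN : ∀ s ≤ i, padicNorm q.minFac (N s) = padicNorm q.minFac q ^ ((i - s) * (k - s)) := by
    intro s hs
    have := padicNorm_layer_one (k := k) hpq Z.1 (s := s) (by omega) (by omega) (by omega)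
    rwa [hZ] at this
  have N_pos : ∀ s ≤ i, 0 < N s := by
    intro s hs
    refine lt_of_le_of_ne (layer_one_nonneg _ _) fun h0 => ?_
    have := normN s hs
    rw [← h0, padicNorm.zero] at this
    exact (pow_pos (padicNorm_natCast_pos (by omega)) _).ne this
  -- `H` is orthogonal to the polynomials of degree less than `i`
  have orthH : ∀ P : ℚ[X], P.natDegree ≤ i - 1 →
      ∑ s ∈ Finset.range (i + 1), H s * P.eval ((q : ℚ) ^ s) = 0 := by
    intro P hP
    rw [← sum_mul_eval_eq_zero (by omega : i - 1 ≤ k) Z.1 hP hh,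
      sum_mul_finrank_inf_eq Z.1 h fun s => P.eval ((q : ℚ) ^ s), hZ]
  have H_eq : ∀ s < i, H s * (qRoots q ((Finset.range i).erase s)).eval ((q : ℚ) ^ s) +
      H i * (qRoots q ((Finset.range i).erase s)).eval ((q : ℚ) ^ i) = 0 := by
    intro s hs
    rw [← sum_range_mul_qRoots_erase q H hs, ← Finset.sum_range_succ]
    exact orthH _ (natDegree_qRoots_erase q hs).le
  have average : ∀ B : Set (Grass F V k), IsSteiner t B → ∑ s ∈ Finset.range (i + 1),
      layer Z.1 (B.indicator (1 : Grass F V k → ℚ)) s * (H s / N s) = C := by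
    intro B hB
    have := sum_layer_mul_layer_div_eq Z.1 (u := B.indicator 1) (h := h) (C := C) fun g => ?_
    · rwa [hZ] at this
    rw [← hC _ (hB.preimage g.symm)]
    refine Eq.trans ?_ ((grassMap g k).sum_comp _)
    refine Finset.sum_congr rfl fun X _ => ?_
    have : grassMap g.symm k (grassMap g k X) = X := (grassMap g k).symm_apply_apply X
    simp only [Set.indicator_apply, Set.mem_preimage, this, Pi.one_apply]
  -- a system with a block containing `Z`, and one with a block meeting `Z` in a hyperplane
  obtain ⟨X₁, hX₁⟩ := exists_finrank_inf_eq_of_layer_one_ne_zero (N_pos i le_rfl).ne'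
  obtain ⟨X₂, hX₂⟩ := exists_finrank_inf_eq_of_layer_one_ne_zero (N_pos (i - 1) (by omega)).ne'
  obtain ⟨B₁, hB₁, hXB₁⟩ := hB.exists_mem (by omega) X₁
  obtain ⟨B₂, hB₂, hXB₂⟩ := hB.exists_mem (by omega) X₂
  set δ : ℕ → ℚ := fun s => layer Z.1 (B₁.indicator (1 : Grass F V k → ℚ)) s -
    layer Z.1 (B₂.indicator (1 : Grass F V k → ℚ)) s with hδ
  have δ_eq : ∀ s, t < s → δ s = (if i = s then 1 else 0) - if i - 1 = s then 1 else 0 := by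
    intro s hs
    simp only [hδ]
    rw [hB₁.layer_indicator hXB₁ (by omega) hs, hB₂.layer_indicator hXB₂ (by omega) hs, hX₁, hX₂]
  have δ_sum : ∑ s ∈ Finset.range (i + 1), δ s * (H s / N s) = 0 := by
    simp_rw [hδ, sub_mul, Finset.sum_sub_distrib, average B₁ hB₁, average B₂ hB₂, sub_self]
  have orthδ : ∀ P : ℚ[X], P.natDegree ≤ t →
      ∑ s ∈ Finset.range (i + 1), δ s * P.eval ((q : ℚ) ^ s) = 0 := by
    intro P hP
    obtain ⟨κ, hκ⟩ := exists_sum_mul_eval_eq (by omega : t ≤ k) Z.1 P hP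
    have e₁ := hκ _ 1 (fun T => congrFun hB₁.upSum_indicator T)
    have e₂ := hκ _ 1 (fun T => congrFun hB₂.upSum_indicator T)
    rw [← hq, sum_mul_finrank_inf_eq Z.1 _ fun s => P.eval ((q : ℚ) ^ s), hZ] at e₁ e₂
    simp_rw [hδ, sub_mul, Finset.sum_sub_distrib, e₁, e₂, sub_self]
  rcases (Nat.succ_le_of_lt hti).eq_or_lt with hi | (hi : t + 2 ≤ i)
  · -- here `δ` is proportional to `H`, and the sum is a sum of squares
    subst hi
    have δi : δ (t + 1) = 1 := by rw [δ_eq _ (by omega)]; simp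
    have prop : ∀ s ∈ Finset.range (t + 1 + 1), H s = H (t + 1) * δ s := by
      intro s hs
      rcases (Nat.lt_succ_iff.1 (Finset.mem_range.1 hs)).lt_or_eq with hs | rfl
      · have h₁ := H_eq s hs
        have h₂ := orthδ _ (natDegree_qRoots_erase q hs).le
        rw [Finset.sum_range_succ, sum_range_mul_qRoots_erase q δ hs, δi] at h₂
        refine mul_right_cancel₀ (qRoots_eval_ne_zero hq1
          (Finset.notMem_erase s (Finset.range (t + 1)))) ?_
        linear_combination h₁ - H (t + 1) * h₂
      · rw [δi, mul_one]
    have hsq : H (t + 1) * ∑ s ∈ Finset.range (t + 1 + 1), δ s ^ 2 / N s = 0 := by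
      rw [← δ_sum, Finset.mul_sum]
      refine Finset.sum_congr rfl fun s hs => ?_
      rw [prop s hs]
      ring
    refine (mul_eq_zero.1 hsq).resolve_right (ne_of_gt ?_)
    refine Finset.sum_pos' (fun s hs => ?_) ⟨t + 1, by simp, ?_⟩
    · exact div_nonneg (sq_nonneg _) (N_pos s (Nat.lt_succ_iff.1 (Finset.mem_range.1 hs))).le
    · rw [δi]
      have := N_pos (t + 1) le_rfl
      positivity
  · -- the terms strictly between `t` and `i - 1` vanish
    have split : ∀ f : ℕ → ℚ, ∑ s ∈ Finset.range (i + 1), δ s * f s =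
        ∑ s ∈ Finset.range (t + 1), δ s * f s + ((-1) * f (i - 1) + 1 * f i) := by
      intro f
      obtain ⟨v, hv⟩ := Nat.exists_eq_add_of_le hi
      have hi₁ : t + 1 + v = i - 1 := by omega
      have hi₂ : t + 1 + (v + 1) = i := by omega
      rw [show i + 1 = t + 1 + (v + 2) by omega, Finset.sum_range_add,
        Finset.sum_range_succ fun x => δ (t + 1 + x) * f (t + 1 + x),
        Finset.sum_range_succ fun x => δ (t + 1 + x) * f (t + 1 + x), hi₁, hi₂,
        δ_eq (i - 1) (by omega), δ_eq i hti, if_neg (by omega), if_pos rfl, if_pos rfl, if_neg (by omega), zero_sub,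
        sub_zero]
      have hmid : ∑ x ∈ Finset.range v, δ (t + 1 + x) * f (t + 1 + x) = 0 := by
        refine Finset.sum_eq_zero fun s hs => ?_
        have := Finset.mem_range.1 hs
        rw [δ_eq _ (by omega), if_neg (by omega), if_neg (by omega), sub_self, zero_mul]
      rw [hmid, zero_add]
    refine eq_zero_of_sum_mul_div_eq_zero (δ := δ) hpq (by omega) ht hi hik H_eq ?_ normN ?_
    · intro s hs
      have := orthδ _ (natDegree_qRoots_erase q hs).le
      rw [split fun s => (qRoots q _).eval ((q : ℚ) ^ s), sum_range_mul_qRoots_erase q δ hs] at this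
      linear_combination this
    · rw [← δ_sum, split]
      simp only [mul_div_assoc]

/-- The dot product on a subspace of `ι → ℚ` is nondegenerate, so a proper subspace of `K` has
a nonzero orthogonal vector in `K`. -/
theorem exists_orthogonal_of_lt {ι : Type*} [Fintype ι] {D K : Submodule ℚ (ι → ℚ)} (h : D < K) :
    ∃ x ∈ K, x ≠ 0 ∧ ∀ y ∈ D, ∑ j, y j * x j = 0 := by
  let b : K →ₗ[ℚ] Dual ℚ K := LinearMap.mk₂ ℚ (fun x y => ∑ j, y.1 j * x.1 j)
    (fun x x' y => by simp [mul_add, Finset.sum_add_distrib])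
    (fun c x y => by simp [Finset.mul_sum, mul_left_comm])
    (fun x y y' => by simp [add_mul, Finset.sum_add_distrib])
    (fun c x y => by simp [Finset.mul_sum, mul_assoc])
  have hb : Function.Injective b := by
    rw [← LinearMap.ker_eq_bot, LinearMap.ker_eq_bot']
    intro x hx
    have h₀ : ∑ j, x.1 j * x.1 j = 0 := LinearMap.congr_fun hx x
    rw [Finset.sum_eq_zero_iff_of_nonneg fun j _ => mul_self_nonneg _] at h₀
    ext j
    exact mul_self_eq_zero.1 (h₀ j (Finset.mem_univ j))
  have hb' := (LinearMap.injective_iff_surjective_of_finrank_eq_finrank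
    (Subspace.dual_finrank_eq (K := ℚ) (V := K)).symm).1 hb
  have hlt : D.comap K.subtype < ⊤ := by
    rw [lt_top_iff_ne_top]
    intro he
    exact h.not_ge (Submodule.comap_subtype_eq_top.1 he)
  obtain ⟨φ, hφ, hφD⟩ := Submodule.exists_le_ker_of_lt_top _ hlt
  obtain ⟨x, rfl⟩ := hb' φ
  refine ⟨x.1, x.2, fun hx => hφ ?_, fun y hy => ?_⟩
  · rw [show x = 0 from Subtype.ext hx, map_zero]
  · exact hφD (show (⟨y, h.le hy⟩ : K) ∈ D.comap K.subtype from hy)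

/-- The vectors with vanishing sums over the blocks through each `t`-dimensional subspace are
linear combinations of characteristic vectors of Steiner systems. -/
theorem IsSteiner.ker_upSum_le_span (hB : IsSteiner t B) (ht : 1 ≤ t) (htk : t < k)
    (hk : k < finrank F V) :
    LinearMap.ker (upSum t : (Grass F V k → ℚ) →ₗ[ℚ] (Grass F V t → ℚ)) ≤
      Submodule.span ℚ ((fun B => B.indicator 1) '' {B : Set (Grass F V k) | IsSteiner t B}) := by
  set K := LinearMap.ker (upSum t : (Grass F V k → ℚ) →ₗ[ℚ] (Grass F V t → ℚ))
  set W := Submodule.span ℚ ((fun B => B.indicator (1 : Grass F V k → ℚ)) ''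
    {B : Set (Grass F V k) | IsSteiner t B}) with hW
  by_contra hle
  have hlt : W ⊓ K < K := lt_of_le_of_ne inf_le_right fun he => hle (inf_eq_right.1 he)
  obtain ⟨h, hhK, hh0, horth⟩ := exists_orthogonal_of_lt hlt
  have hmem : ∀ B : Set (Grass F V k), IsSteiner t B → B.indicator (1 : Grass F V k → ℚ) ∈ W :=
    fun B hB => Submodule.subset_span ⟨B, hB, rfl⟩
  have hC : ∀ B' : Set (Grass F V k), IsSteiner t B' →
      ∑ X, B'.indicator (1 : Grass F V k → ℚ) X * h X =
        ∑ X, B.indicator (1 : Grass F V k → ℚ) X * h X := by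
    intro B' hB'
    have hd : B'.indicator (1 : Grass F V k → ℚ) - B.indicator 1 ∈ W ⊓ K := by
      refine ⟨W.sub_mem (hmem _ hB') (hmem _ hB), LinearMap.mem_ker.2 ?_⟩
      rw [ map_sub, hB'.upSum_indicator, hB.upSum_indicator, sub_self]
    have := horth _ hd
    simp_rw [Pi.sub_apply, sub_mul, Finset.sum_sub_distrib] at this
    exact sub_eq_zero.1 this
  have hn := hB.add_lt_finrank htk hk
  have step : ∀ i, t ≤ i → i ≤ k → k + i ≤ finrank F V → upSum i h = 0 := by
    intro i hti
    induction i, hti using Nat.le_induction with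
    | base => exact fun _ _ => hhK
    | succ i hti ih =>
      intro h₁ h₂
      exact upSum_eq_zero_of_sum_indicator_eq hB ht (by omega) h₁ h₂
        (by simpa using ih (by omega) (by omega)) hC
  refine hh0 ?_
  by_cases h2k : k + k ≤ finrank F V
  · rw [← upSum_self h]
    exact step k htk.le le_rfl h2k
  · exact eq_zero_of_upSum_eq_zero (a := finrank F V - k) (by omega) (by omega)
      (step _ (by omega) (by omega) (by omega))

theorem IsSteiner.finrank_span (hB : IsSteiner t B) (ht : 1 ≤ t) (htk : t < k)
    (hk : k < finrank F V) :
    (finrank ℚ (Submodule.span ℚ ((fun B => B.indicator (1 : Grass F V k → ℚ)) ''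
      {B : Set (Grass F V k) | IsSteiner t B})) : ℚ) =
      Fintype.card (Grass F V k) - Fintype.card (Grass F V t) + 1 := by
  have hker := hB.ker_upSum_le_span ht htk hk
  set K := LinearMap.ker (upSum t : (Grass F V k → ℚ) →ₗ[ℚ] (Grass F V t → ℚ)) with hK
  have hn := hB.add_lt_finrank htk hk
  set χ := B.indicator (1 : Grass F V k → ℚ) with hχ
  have hspan : Submodule.span ℚ ((fun B => B.indicator (1 : Grass F V k → ℚ)) ''
      {B : Set (Grass F V k) | IsSteiner t B}) = K ⊔ Submodule.span ℚ {χ} := by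
    apply le_antisymm
    · rw [Submodule.span_le]
      rintro _ ⟨B', hB', rfl⟩
      have hd : B'.indicator (1 : Grass F V k → ℚ) - χ ∈ K := by
        rw [hK, LinearMap.mem_ker, map_sub, hB'.upSum_indicator, hB.upSum_indicator, sub_self]
      have := Submodule.add_mem_sup hd (Submodule.mem_span_singleton_self (R := ℚ) χ)
      rwa [sub_add_cancel] at this
    · refine sup_le hker ?_
      rw [Submodule.span_singleton_le_iff_mem]
      exact Submodule.subset_span ⟨B, hB, rfl⟩
  obtain ⟨T, -, -, hT⟩ := exists_between_finrank_eq (R := ⊥) (X := (⊤ : Submodule F V)) (a := t)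
    bot_le (by simp) (by rw [finrank_top]; omega)
  have hχK : χ ∉ K := by
    rw [hK, LinearMap.mem_ker, hχ, hB.upSum_indicator]
    intro h
    simpa using congrFun h ⟨T, hT⟩
  have hχ0 : χ ≠ 0 := fun h => hχK (h ▸ K.zero_mem)
  have hrank := LinearMap.finrank_range_add_finrank_ker
    (upSum t : (Grass F V k → ℚ) →ₗ[ℚ] (Grass F V t → ℚ))
  rw [LinearMap.range_eq_top.2 (upSum_surjective htk.le hn.le), finrank_top,
    finrank_fintype_fun_eq_card, finrank_fintype_fun_eq_card, ← hK] at hrank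
  rw [hspan, finrank_sup_of_disjoint ((Submodule.disjoint_span_singleton' hχ0).2 hχK),
    finrank_span_singleton hχ0, ← hrank]
  push_cast
  ring

end Steiner

theorem mem_steinerSystems_iff {F : Type*} [Field F] {t k n : ℕ} (B : Set (Gr F n k)) :
    B ∈ steinerSystems F t k n ↔ IsSteiner t B := by
  refine forall_congr' fun T => ?_
  rw [Nat.cast_one, Set.encard_eq_one]
  constructor
  · rintro ⟨X, hX⟩
    exact ⟨X, hX.ge rfl, fun Y hY => hX.le hY⟩
  · rintro ⟨X, hX, huniq⟩
    exact ⟨X, Set.eq_singleton_iff_unique_mem.2 ⟨hX, huniq⟩⟩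

end QSteiner

theorem theorem1 {F : Type*} [Field F] [Finite F] (q : ℕ) (hq : Nat.card F = q)
    (t k n : ℕ) (ht : 1 ≤ t) (htk : t < k) (hkn : k < n)
    (hne : (QSteiner.steinerSystems F t k n).Nonempty) :
    (Module.finrank ℚ (QSteiner.steinerSpace F t k n) : ℚ) =
      QSteiner.gaussBinom q n k - QSteiner.gaussBinom q n t + 1 := by
  subst hq
  obtain ⟨B, hB⟩ := hne
  have hS : QSteiner.steinerSystems F t k n = {B | QSteiner.IsSteiner t B} :=
    Set.ext QSteiner.mem_steinerSystems_iff
  have hn : Module.finrank F (Fin n → F) = n := by simp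
  have h := ((QSteiner.mem_steinerSystems_iff B).1 hB).finrank_span ht htk (by omega)
  rw [QSteiner.card_grass k (by omega), QSteiner.card_grass t (by omega), hn] at h
  rw [← h, QSteiner.steinerSpace, hS]
  rfl
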